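/- \textbf{Setting.} Let $M=(\mathcal S,\mathcal A,\mathcal P,c,\gamma)$ be a finite discounted Markov decision process, $\gamma\in(0,1)$, with policies $\pi(\cdot|s)\in\Delta_{|\mathcal A|}$. For $p,q\in\Delta_{|\mathcal A|}$ with $q>0$ let $D_q^p=\sum_a p(a)\log\frac{p(a)}{q(a)}$. For each state $s$ let $h^p(s)$ be a continuous convex function of $p\in\Delta_{|\mathcal A|}$, differentiable at strictly positive $p$, such that, for some $\mu>0$, $h^{p}(s)-h^{p'}(s)-\langle\nabla h^{p'}(s,\cdot),p-p'\rangle\ge\mu D_{p'}^{p}$ for all $p\in\Delta_{|\mathcal A|}$ and all strictly positive $p'\in\Delta_{|\mathcal A|}$. Let $V^\pi(s)$ and $Q^\pi(s,a)$ be the expected values of $\sum_{t\ge0}\gamma^t[c(s_t,a_t)+h^{\pi}(s_t)]$ under $\pi$ given $s_0=s$, respectively $(s_0,a_0)=(s,a)$. Let $\pi^*$ minimize $V^\pi(s)$ simultaneously for all $s$, let $\nu^*$ be a stationary distribution of the chain induced by $\pi^*$, and put $f(\pi)=\mathbb E_{s\sim\nu^*}[V^\pi(s)]$, $\mathcal D(\pi,\pi^*)=\mathbb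 E_{s\sim\nu^*}[D_{\pi(\cdot|s)}^{\pi^*(\cdot|s)}]$. Put $$\eta=\tfrac{1-\gamma}{\gamma\mu},\quad l=\lceil\log_\gamma\tfrac14\rceil,\quad m=1+\mu\eta,\quad L\ge0,\quad \Lambda=4\max\{\eta L,m\},\quad \kappa=\max\{1,\tfrac{(1-\gamma)L}{\mu}\}.$$ \textbf{Algorithm (inexact SPMD).} Let $\pi_0=v_0$ be the uniform policy. In iteration $k$, given an estimator $\mathcal Q^{\pi_k,\xi_k}$ of $Q^{\pi_k}$, apply for each state $s$ $T_k\ge1$ accelerated gradient iterations with $x_0=y_0=\pi_0(\cdot|s)$ to $\min_{p\in\Delta_{|\mathcal A|}}\{\phi(p)+\chi(p)\}$, where $\phi(p)=\eta[\langle\mathcal Q^{\pi_k,\xi_k}(s,\cdot),p\rangle+h^p(s)]$ and $\chi(p)=D_{v_k(\cdot|s)}^p$: $$\underline x_t=(1-\rho_t)y_{t-1}+\rho_tx_{t-1},\quad x_t=\arg\min_{p\in\Delta_{|\mathcal A|}}\{r_t[\langle\nabla\phi(\underline x_t),p\rangle+\mu\eta D_{\underline x_t}^p+\chi(p)]+D_{x_{t-1}}^p\},\quad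 y_t=(1-\rho_t)y_{t-1}+\rho_tx_t,$$ with $\rho_t=\frac2{t+1}$, $r_t=\frac t{2\Lambda}$ for $t\le\lfloor2\sqrt{\Lambda/m}-1\rfloor$ and $\rho_t=\sqrt{m/\Lambda}$, $r_t=\frac1{\sqrt{\Lambda m}-m}$ otherwise; then $(\pi_{k+1},v_{k+1})=(y_{T_k},x_{T_k})$. Put $\varepsilon(t)=2\Lambda\min\{(1-\sqrt{m/\Lambda})^{t-1},\frac2{t(t+1)}\}$ for $t\ge 1$. Assume that $\nabla h^{p}(s,\cdot)$ is $L$-Lipschitz (from $\|\cdot\|_1$ to $\|\cdot\|_\infty$) on some convex set of strictly positive $p$ that almost surely contains all the inner iterates $x_t,y_t$ at state $s$, and that for all $k\ge0$, conditionally on $\xi_0,\dots,\xi_{k-1}$, the $\ell_\infty$ bias of $\mathcal Q^{\pi_k,\xi_k}$ is at most $\varsigma_k=(1-\gamma)2^{-(\lfloor k/l\rfloor+2)}$ and $\mathbb E\|\mathcal Q^{\pi_k,\xi_k}-Q^{\pi_k}\|_\infty^2\le\sigma_k^2=2^{-(\lfloor k/l\rfloor+2)}$. \textbf{Theorem.}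 (a) Suppose $\varepsilon_k:=\varepsilon(T_k)\le(1-\gamma)^2 2^{-(\lfloor (k+1)/l\rfloor+2)}$ for all $k\ge0$. Put $$B=f(\pi_0)-f(\pi^*)+\tfrac1{1-\gamma}\Big(\mu\log|\mathcal A|+\tfrac{5(2-\gamma)}2+\tfrac5{8\gamma\mu}+\tfrac{5\mu\gamma^2(1+\gamma)\log|\mathcal A|}4\Big).$$ Then for every $k\ge0$ (all the random variables being integrable) $$\mathbb E\big[f(\pi_k)-f(\pi^*)+\tfrac\mu{1-\gamma}\mathcal D(v_k,\pi^*)\big]\le2^{-\lfloor k/l\rfloor}B,$$ $$\mathbb E\big[f(\pi_k)-f(\pi^*)+\tfrac\mu{1-\gamma}\mathcal D(\pi_k,\pi^*)\big]\le20(1+\log\kappa)\,2^{-\lfloor k/l\rfloor}B .$$ In particular, for every $\epsilon>0$, with $n(\epsilon)=\max\{0,\lceil\log_2(B/\epsilon)\rceil\}$, one has $\mathbb E[f(\pi_{k})-f(\pi^*)]\le\epsilon$ for $k=l\,n(\epsilon)$. (b) The least $T_k\ge1$ satisfying the condition in (a) exist, and with them the number $N(\epsilon)=\sum_{k<l\,n(\epsilon)}T_k$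 of evaluations of $\nabla h$ per state needed for this satisfies, for every $\epsilon>0$, $$N(\epsilon)\le20\,l\,n(\epsilon)\sqrt{\kappa}\,\Big(n(\epsilon)+\log\tfrac{\kappa}{\gamma(1-\gamma)^2}\Big),$$ and, with all the problem data fixed, $N(\epsilon)=O\big((\log_\gamma\epsilon)\sqrt{\kappa}\,\log(1/\epsilon)\big)$ as $\epsilon\downarrow0$. -/

import Mathlib

open MeasureTheory Filter Topology

noncomputable section

namespace PMD

/-- A finite discounted Markov decision process: transition probabilities `P s a s'` (of moving to
`s'` from `s` under action `a`), costs `c s a`, and a discount factor `γ` in `(0,1)`. -/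
structure MDP (S A : Type*) [Fintype S] where
  P : S → A → S → ℝ
  c : S → A → ℝ
  γ : ℝ
  P_mem : ∀ s a, P s a ∈ stdSimplex ℝ S
  γ_pos : 0 < γ
  γ_lt_one : γ < 1

section Basic

variable {S A : Type*} [Fintype S] [Fintype A]

/-- A policy: `π s` is a probability vector over the actions for every state `s`. -/
def IsPolicy (π : S → A → ℝ) : Prop := ∀ s, π s ∈ stdSimplex ℝ A

/-- The inner product over the action space. -/
def pair (g p : A → ℝ) : ℝ := ∑ a, g a * p a

/-- `p ↦ ⟨g, p⟩` as a continuous linear functional. -/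
def pairCLM (g : A → ℝ) : (A → ℝ) →L[ℝ] ℝ :=
  ∑ a, g a • ContinuousLinearMap.proj (R := ℝ) (φ := fun _ : A => ℝ) a

/-- The Bregman distance `D_q^p` of the negative entropy on the simplex, that is, the
Kullback--Leibler divergence of `p` relative to `q` (used only for strictly positive `q`). -/
def KL (p q : A → ℝ) : ℝ := ∑ a, p a * Real.log (p a / q a)

/-- The `ℓ₁` distance. -/
def l1dist (p q : A → ℝ) : ℝ := ∑ a, |p a - q a|

/-- The relative interior of the simplex: the strictly positive probability vectors. -/
def posSimplex (A : Type*) [Fintype A] : Set (A → ℝ) := {p | p ∈ stdSimplex ℝ A ∧ ∀ a, 0 < p a}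

/-- The uniform policy. -/
def uniformPolicy (S A : Type*) [Fintype A] : S → A → ℝ := fun _ _ => 1 / (Fintype.card A : ℝ)

/-- One step of the Markov chain of policy `π`, acting on functions:
`(stepOp M π g) s = 𝔼[g(s₁) | s₀ = s, a₀ ∼ π(·|s₀), s₁ ∼ P(·|s₀,a₀)]`. -/
def stepOp (M : MDP S A) (π : S → A → ℝ) (g : S → ℝ) : S → ℝ :=
  fun s => ∑ a, π s a * ∑ s', M.P s a s' * g s'

/-- `𝔼[c(s,a) + h^π(s) | a ∼ π(·|s)]`. -/
def stageCost (M : MDP S A) (h : S → (A → ℝ) → ℝ) (π : S → A → ℝ) : S → ℝ :=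
  fun s => ∑ a, π s a * M.c s a + h s (π s)

/-- The state-value function
`V^π(s) = 𝔼[∑ₜ γᵗ (c(sₜ,aₜ) + h^π(sₜ)) | s₀ = s, aₜ ∼ π(·|sₜ), sₜ₊₁ ∼ P(·|sₜ,aₜ)]`;
`(stepOp M π)^[t] g s` is `𝔼[g(sₜ) | s₀ = s]`. -/
def V (M : MDP S A) (h : S → (A → ℝ) → ℝ) (π : S → A → ℝ) (s : S) : ℝ :=
  ∑' t : ℕ, M.γ ^ t * (stepOp M π)^[t] (stageCost M h π) s

/-- The action-value function
`Q^π(s,a) = 𝔼[∑ₜ γᵗ (c(sₜ,aₜ) + h^π(sₜ)) | s₀ = s, a₀ = a, aₜ ∼ π(·|sₜ), sₜ₊₁ ∼ P(·|sₜ,aₜ)]`. -/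
def Q (M : MDP S A) (h : S → (A → ℝ) → ℝ) (π : S → A → ℝ) (s : S) (a : A) : ℝ :=
  M.c s a + h s (π s) +
    ∑' t : ℕ, M.γ ^ (t + 1) * ∑ s', M.P s a s' * (stepOp M π)^[t] (stageCost M h π) s'

/-- An optimal policy: it minimizes the value simultaneously at all states. -/
def IsOptimal (M : MDP S A) (h : S → (A → ℝ) → ℝ) (πs : S → A → ℝ) : Prop :=
  IsPolicy πs ∧ ∀ π : S → A → ℝ, IsPolicy π → ∀ s, V M h πs s ≤ V M h π s

/-- A stationary state distribution of the Markov chain induced by `π`. -/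
def IsStationary (M : MDP S A) (π : S → A → ℝ) (ν : S → ℝ) : Prop :=
  ν ∈ stdSimplex ℝ S ∧ ∀ s', ∑ s, ν s * ∑ a, π s a * M.P s a s' = ν s'

/-- The objective `f(π) = 𝔼_{s ∼ ν}[V^π(s)]`. -/
def objective (M : MDP S A) (h : S → (A → ℝ) → ℝ) (ν : S → ℝ) (π : S → A → ℝ) : ℝ :=
  ∑ s, ν s * V M h π s

/-- `𝒟(π, π*) = 𝔼_{s ∼ ν}[D_π^{π*}(s)]`. -/
def avgDist (ν : S → ℝ) (π πs : S → A → ℝ) : ℝ := ∑ s, ν s * KL (πs s) (π s)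

/-- `h` (a function of the state and of the action distribution at that state) is a `μ`-strongly
convex regularizer with gradient `g`: it is continuous and convex on the simplex, differentiable at
the strictly positive points, and
`h(p) - [h(p') + ⟨∇h(p'), p - p'⟩] ≥ μ D_{p'}^p`. -/
structure IsStronglyConvexReg (h : S → (A → ℝ) → ℝ) (g : S → (A → ℝ) → (A → ℝ)) (μ : ℝ) :
    Prop where
  continuousOn : ∀ s, ContinuousOn (h s) (stdSimplex ℝ A)
  convexOn : ∀ s, ConvexOn ℝ (stdSimplex ℝ A) (h s)
  hasGradient : ∀ s, ∀ p ∈ posSimplex A,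
    HasFDerivWithinAt (h s) (pairCLM (g s p)) (stdSimplex ℝ A) p
  strong : ∀ s, ∀ p ∈ stdSimplex ℝ A, ∀ p' ∈ posSimplex A,
    μ * KL p p' ≤ h s p - (h s p' + pair (g s p') (p - p'))

/-- `R s` is a convex set of strictly positive action distributions on which the gradient of `h(s)`
is `L`-Lipschitz (from the `ℓ₁` norm to its dual, the `ℓ_∞` norm). -/
structure IsSmoothOn (g : S → (A → ℝ) → (A → ℝ)) (L : ℝ) (R : S → Set (A → ℝ)) : Prop where
  subset : ∀ s, R s ⊆ posSimplex A
  convex : ∀ s, Convex ℝ (R s)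
  lipschitz : ∀ s, ∀ p ∈ R s, ∀ p' ∈ R s, ∀ a, |g s p a - g s p' a| ≤ L * l1dist p p'

/-! ### Accelerated gradient descent on the simplex -/

/-- `T` iterations of accelerated gradient descent with parameters `q, r, ρ`, started at
`x₀ = y₀ = start`, for `min_{p ∈ Δ} φ(p) + χ(p)`, where `gφ` is the gradient of `φ` and `φ` is
`μφ`-strongly convex relative to `D`. Iteration `t` evaluates `gφ` once, at the point `x̲ₜ`. -/
structure IsAGD (gφ : (A → ℝ) → (A → ℝ)) (μφ : ℝ) (χ : (A → ℝ) → ℝ) (q r ρ : ℕ → ℝ)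
    (start : A → ℝ) (T : ℕ) (x y : ℕ → A → ℝ) : Prop where
  x_zero : x 0 = start
  y_zero : y 0 = start
  x_mem : ∀ t < T, x (t + 1) ∈ stdSimplex ℝ A
  x_step : ∀ t < T, ∀ z : A → ℝ, z = (1 - q (t + 1)) • y t + q (t + 1) • x t →
    IsMinOn (fun p => r (t + 1) * (pair (gφ z) p + μφ * KL p z + χ p) + KL p (x t))
      (stdSimplex ℝ A) (x (t + 1))
  y_step : ∀ t < T, y (t + 1) = (1 - ρ (t + 1)) • y t + ρ (t + 1) • x (t + 1)

end Basic

/-- The switching index `t₀ = ⌊2 √(Λ/m) - 1⌋`, for smoothness parameter `Λ` and total strong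
convexity modulus `m`. -/
def agdSwitch (Λ m : ℝ) : ℕ := ⌊2 * Real.sqrt (Λ / m) - 1⌋₊

/-- The averaging weights `ρₜ` (also used as `qₜ`). -/
def agdWeight (Λ m : ℝ) (t : ℕ) : ℝ :=
  if t ≤ agdSwitch Λ m then 2 / ((t : ℝ) + 1) else Real.sqrt (m / Λ)

/-- The step sizes `rₜ`. -/
def agdStepsize (Λ m : ℝ) (t : ℕ) : ℝ :=
  if t ≤ agdSwitch Λ m then (t : ℝ) / (2 * Λ) else 1 / (Real.sqrt (Λ * m) - m)

/-- The accuracy `ε(t) = 2 Λ min {(1 - √(m/Λ))^(t-1), 2/(t(t+1))}` after `t ≥ 1` iterations. -/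
def agdAccuracy (Λ m : ℝ) (t : ℕ) : ℝ :=
  2 * Λ * min ((1 - Real.sqrt (m / Λ)) ^ (t - 1)) (2 / ((t : ℝ) * ((t : ℝ) + 1)))

/-! ### Parameters of the stochastic policy mirror descent method -/

/-- The stepsize `η = (1-γ)/(γ μ)`. -/
def stepsize (γ μ : ℝ) : ℝ := (1 - γ) / (γ * μ)

/-- `l = ⌈log_γ (1/4)⌉`. -/
def epochLen (γ : ℝ) : ℕ := ⌈Real.logb γ (1 / 4)⌉₊

/-- `2^{-(⌊k/l⌋ + 2)}`. -/
def decay (γ : ℝ) (k : ℕ) : ℝ := (1 / 2 : ℝ) ^ (k / epochLen γ + 2)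

/-- The modulus `1 + μ η` of the subproblems. -/
def subModulus (γ μ : ℝ) : ℝ := 1 + stepsize γ μ * μ

/-- The smoothness parameter `4 max {η L, 1 + μ η}` given to the accelerated gradient method. -/
def subSmooth (γ μ L : ℝ) : ℝ := 4 * max (stepsize γ μ * L) (subModulus γ μ)

/-- The numbers `T k ≥ 1` of inner iterations reach the accuracies
`ε_k = ε(T_k) ≤ (1-γ)² 2^{-(⌊(k+1)/l⌋ + 2)}`. -/
def AdmissibleSteps (γ μ L : ℝ) (T : ℕ → ℕ) : Prop :=
  ∀ k, 1 ≤ T k ∧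
    agdAccuracy (subSmooth γ μ L) (subModulus γ μ) (T k) ≤ (1 - γ) ^ 2 * decay γ (k + 1)

/-- The least admissible number of inner iterations at outer iteration `k`. -/
def leastSteps (γ μ L : ℝ) (k : ℕ) : ℕ :=
  sInf {t : ℕ | 1 ≤ t ∧
    agdAccuracy (subSmooth γ μ L) (subModulus γ μ) t ≤ (1 - γ) ^ 2 * decay γ (k + 1)}

/-- `max {1, (1-γ)L/μ}`; here `(1-γ)L/μ = ηL/(1+μη)` is the condition number of the subproblems. -/
def condNumber (γ μ L : ℝ) : ℝ := max 1 ((1 - γ) * L / μ)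

/-- The bracket in the convergence bound, for initial gap `gap = f(π₀) - f(π*)` and `n = |A|`. -/
def rateConst (γ μ gap : ℝ) (n : ℕ) : ℝ :=
  gap + 1 / (1 - γ) * (μ * Real.log n + 5 * (2 - γ) / 2 + 5 / (8 * γ * μ)
    + 5 * μ * γ ^ 2 * (1 + γ) * Real.log n / 4)

/-- `⌈log₂ (B/ε)⌉` epochs (none if `B ≤ ε`). -/
def epochs (B ε : ℝ) : ℕ := ⌈Real.logb 2 (B / ε)⌉₊

/-- The number of evaluations of the gradient `∇h(s,·)` at each state during the first `K` outer
iterations: one for each of the `T k` inner iterations. -/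
def gradEvals (T : ℕ → ℕ) (K : ℕ) : ℕ := ∑ k ∈ Finset.range K, T k

section Method

variable {S A : Type*} [Fintype S] [Fintype A]

/-- The stochastic policy mirror descent method with inexact subproblem solutions, for a given
realization `Qhat` of the estimators. Outer iteration `k` applies, at each state `s`, `T k`
accelerated gradient iterations started at the uniform distribution to
`min_{p ∈ Δ} η [⟨Qhat k s, p⟩ + h(s)(p)] + D_{v k s}^p`,
with `φ = η [⟨Qhat k s, ·⟩ + h(s)]` and `χ = D_{v k s}`; here `x k t s, y k t s` are the inner
iterates and `gradh` is the gradient of `h`. -/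
structure IsInexactSPMD (M : MDP S A) (gradh : S → (A → ℝ) → (A → ℝ)) (μ L : ℝ)
    (T : ℕ → ℕ) (Qhat : ℕ → S → A → ℝ) (π v : ℕ → S → A → ℝ) (x y : ℕ → ℕ → S → A → ℝ) :
    Prop where
  π_zero : π 0 = uniformPolicy S A
  v_zero : v 0 = uniformPolicy S A
  inner : ∀ k s,
    IsAGD (fun p => stepsize M.γ μ • (Qhat k s + gradh s p)) (stepsize M.γ μ * μ)
      (fun p => KL p (v k s))
      (agdWeight (subSmooth M.γ μ L) (subModulus M.γ μ))
      (agdStepsize (subSmooth M.γ μ L) (subModulus M.γ μ))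
      (agdWeight (subSmooth M.γ μ L) (subModulus M.γ μ))
      (uniformPolicy S A s) (T k) (fun t => x k t s) (fun t => y k t s)
  π_succ : ∀ k, π (k + 1) = y k (T k)
  v_succ : ∀ k, v (k + 1) = x k (T k)

/-- The conditions on the estimators `Qhat k` of `Q^{π k}`; `ℱ k` is the information in
`ξ_0, …, ξ_{k-1}`. The conditional bias is at most `ς k` and the conditional expected squared error
at most `σsq k`, in the `ℓ_∞` norm. -/
structure IsEstimator {Ω : Type*} [m : MeasurableSpace Ω] (ℙ : Measure Ω) (ℱ : Filtration ℕ m)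
    (M : MDP S A) (h : S → (A → ℝ) → ℝ) (ς σsq : ℕ → ℝ) (Qhat : ℕ → Ω → S → A → ℝ)
    (π : ℕ → Ω → S → A → ℝ) : Prop where
  measurable : ∀ k s a, StronglyMeasurable[ℱ (k + 1)] (fun ω => Qhat k ω s a)
  bias : ∀ k s a, ∀ᵐ ω ∂ℙ,
    |(ℙ[fun ω' => Qhat k ω' s a | ℱ k]) ω - Q M h (π k ω) s a| ≤ ς k
  integrable : ∀ k, Integrable (fun ω => ‖Qhat k ω - Q M h (π k ω)‖ ^ 2) ℙ
  error : ∀ k, ∀ᵐ ω ∂ℙ,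
    (ℙ[fun ω' => ‖Qhat k ω' - Q M h (π k ω')‖ ^ 2 | ℱ k]) ω ≤ σsq k

end Method

end PMD

end

open PMD

/-! The potential `f(π_k) - f(π*) + μ/(1-γ) 𝒟(v_k, π*)` contracts by the factor `γ` per outer
iteration, up to small errors (`IsInexactSPMD.potential_succ_le`). The stepsize makes the subproblem
modulus equal to `1/γ`. After division by `η`, the divergence from `v_{k+1}` therefore carries the
weight `μ/(1-γ)` and that from `v_k` carries `γ` times as much. Averaging over the stationary
distribution of `π*` turns the advantage of `π_k` over `π*` into `(1-γ)(f(π_k) - f(π*))`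
(`sum_stationary_advantage`), so the objective contracts at the same rate.

An exact mirror step would supply a three-point inequality at its minimizer. The accelerated method
supplies a substitute valid for every comparison point `p` (`IsAGD.accuracy`): the objective is
evaluated at the averaged iterate `y_T`, the divergence at the prox-iterate `x_T`, and the error is
`ε(T) KL p start`. This is why two sequences `π` and `v` are carried. Taking `p = y_T` shows that
`π_k` and `v_k` are close (`IsInexactSPMD.KL_last_le`).

Estimation noise enters in two ways. Against `π_k - π*`, which is known before the sample is drawn,
only the conditional bias survives. Against `π_{k+1} - π_k`, the difference is split at `v_k`; by
Pinsker and Young one part is absorbed by the prox term and the other by the closeness of `π_k` to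
`v_k`, leaving the squared error. The error tolerances are constant over an epoch of `l` iterations,
and `γ^l ≤ 1/4` makes each epoch halve the bound (`le_half_pow_of_recursion`).

To bound the divergence from `π_k` itself, the averaging weights give `π_k ≥ √(m/Λ) v_k` pointwise.
By `KL_le_of_mul_le` this costs only a factor logarithmic in `√(Λ/m) = 2√κ`. The same quantity gives
the linear rate of the inner method, hence inner iteration counts of order `√κ` times a logarithm.
-/

namespace PMD

/-! ### Kullback–Leibler divergence: Pinsker and the three-point inequality -/

section Divergence

open InformationTheory (klFun)

/-- The difference of the two sides is convex and vanishes to first order at `u = 1`. This sharp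
rational bound is what produces Pinsker's inequality with the constant 2. -/
theorem three_mul_sq_div_le_klFun {u : ℝ} (hu : 0 ≤ u) :
    3 / 2 * (u - 1) ^ 2 / (u + 2) ≤ klFun u := by
  set F : ℝ → ℝ := fun u => klFun u - 3 / 2 * (u - 4 + 9 / (u + 2)) with hF
  have hd : ∀ u : ℝ, 0 < u →
      HasDerivAt F (Real.log u - 3 / 2 * (1 - 9 / (u + 2) ^ 2)) u := by
    intro u hu
    have h1 := InformationTheory.hasDerivAt_klFun hu.ne'
    have h3 : HasDerivAt (fun u : ℝ => u + 2) 1 u := (hasDerivAt_id' u).add_const 2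
    have h4 := (h3.fun_inv (by positivity)).const_mul 9
    have h2 : HasDerivAt (fun u : ℝ => u - 4 + 9 / (u + 2)) (1 - 9 / (u + 2) ^ 2) u := by
      refine (((hasDerivAt_id' u).sub_const 4).fun_add h4).congr_deriv ?_
      ring
    exact h1.sub (h2.const_mul _)
  have hd2 : ∀ u : ℝ, 0 < u →
      HasDerivAt (deriv F) (1 / u - 27 / (u + 2) ^ 3) u := by
    intro u hu
    have h3 : HasDerivAt (fun u : ℝ => Real.log u - 3 / 2 * (1 - 9 / (u + 2) ^ 2))
        (1 / u - 27 / (u + 2) ^ 3) u := by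
      have h1 := Real.hasDerivAt_log hu.ne'
      have h4 : HasDerivAt (fun u : ℝ => u + 2) 1 u := (hasDerivAt_id' u).add_const 2
      have h2 := (((h4.fun_pow 2).fun_inv (by positivity)).const_mul 9)
      refine (h1.fun_sub ((h2.const_sub 1).const_mul (3 / 2))).congr_deriv ?_
      have : u + 2 ≠ 0 := by positivity
      field_simp
      ring
    refine h3.congr_of_eventuallyEq ?_
    filter_upwards [lt_mem_nhds hu] with w hw using (hd w hw).deriv
  have hcont : ContinuousOn F (Set.Ici 0) := by
    refine InformationTheory.continuous_klFun.continuousOn.sub ?_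
    refine continuousOn_const.mul ((continuousOn_id.sub continuousOn_const).add ?_)
    refine continuousOn_const.div (continuousOn_id.add continuousOn_const) ?_
    intro x hx
    have : (0 : ℝ) ≤ x := hx
    simp; positivity
  have hconv : ConvexOn ℝ (Set.Ici 0) F := by
    refine convexOn_of_deriv2_nonneg (convex_Ici 0) hcont ?_ ?_ ?_
    · rw [interior_Ici]
      exact fun x hx => (hd x hx).differentiableAt.differentiableWithinAt
    · rw [interior_Ici]
      exact fun x hx => (hd2 x hx).differentiableAt.differentiableWithinAt
    · rw [interior_Ici]
      intro x hx
      have hx : (0 : ℝ) < x := hx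
      have : deriv^[2] F x = 1 / x - 27 / (x + 2) ^ 3 := (hd2 x hx).deriv
      rw [this, sub_nonneg, div_le_div_iff₀ (by positivity) hx]
      -- Convexity rests on the factorization `(x+2)^3 - 27x = (x-1)^2 (x+8)`.
      nlinarith [mul_nonneg (sq_nonneg (x - 1)) (by linarith : 0 ≤ x + 8)]
  have hmin : IsMinOn F (Set.Ici 0) 1 := by
    refine hconv.isMinOn_of_rightDeriv_eq_zero (by simp) ?_
    rw [(hd 1 one_pos).hasDerivWithinAt.derivWithin (uniqueDiffWithinAt_Ioi 1)]
    norm_num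
  have h1 : F 1 ≤ F u := hmin hu
  have h2 : (u - 1) ^ 2 / (u + 2) = u - 4 + 9 / (u + 2) := by field_simp; ring
  rw [mul_div_assoc, h2]
  simp only [hF, InformationTheory.klFun_one] at h1
  linarith

variable {A : Type*} [Fintype A]

theorem KL_eq_sum_klFun {p q : A → ℝ} (hp : p ∈ stdSimplex ℝ A) (hq : q ∈ posSimplex A) :
    KL p q = ∑ a, q a * klFun (p a / q a) := by
  have h1 : ∑ a, q a * klFun (p a / q a)
      = ∑ a, p a * Real.log (p a / q a) + ∑ a, q a - ∑ a, p a := by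
    rw [← Finset.sum_add_distrib, ← Finset.sum_sub_distrib]
    refine Finset.sum_congr rfl fun a _ => ?_
    have := (hq.2 a).ne'
    rw [InformationTheory.klFun_apply]
    field_simp
  rw [h1, hp.2, hq.1.2, KL]
  ring

theorem KL_nonneg {p q : A → ℝ} (hp : p ∈ stdSimplex ℝ A) (hq : q ∈ posSimplex A) :
    0 ≤ KL p q := by
  rw [KL_eq_sum_klFun hp hq]
  exact Finset.sum_nonneg fun a _ => mul_nonneg (hq.2 a).le
    (InformationTheory.klFun_nonneg (div_nonneg (hp.1 a) (hq.2 a).le))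

theorem KL_self {p : A → ℝ} (hp : p ∈ posSimplex A) : KL p p = 0 := by
  refine Finset.sum_eq_zero fun a _ => ?_
  rw [div_self (hp.2 a).ne', Real.log_one, mul_zero]

/-- Pinsker's inequality. -/
theorem sq_l1dist_le {p q : A → ℝ} (hp : p ∈ stdSimplex ℝ A) (hq : q ∈ posSimplex A) :
    l1dist p q ^ 2 ≤ 2 * KL p q := by
  -- Cauchy–Schwarz with the weights `(p + 2q)/3`, which sum to one and match the denominator `u +
  -- 2` at `u = p/q`.
  have hg : ∀ a ∈ Finset.univ, 0 < (p a + 2 * q a) / 3 := fun a _ => by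
    have := hp.1 a
    have := hq.2 a
    positivity
  have h1 := Finset.sq_sum_div_le_sum_sq_div Finset.univ (fun a => |p a - q a|) hg
  have h2 : ∑ a, (p a + 2 * q a) / 3 = 1 := by
    rw [← Finset.sum_div, Finset.sum_add_distrib, ← Finset.mul_sum, hp.2, hq.1.2]
    norm_num
  rw [h2, div_one] at h1
  refine h1.trans ?_
  rw [KL_eq_sum_klFun hp hq, Finset.mul_sum]
  refine Finset.sum_le_sum fun a _ => ?_
  have hpa := hp.1 a
  have hqa := hq.2 a
  have h3 := three_mul_sq_div_le_klFun (div_nonneg hpa hqa.le)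
  have h4 : |p a - q a| ^ 2 / ((p a + 2 * q a) / 3)
      = 2 * (q a * (3 / 2 * (p a / q a - 1) ^ 2 / (p a / q a + 2))) := by
    have : p a + 2 * q a ≠ 0 := by positivity
    have : p a / q a + 2 ≠ 0 := by positivity
    rw [sq_abs]
    have e : p a / q a + 2 = (p a + 2 * q a) / q a := by field_simp
    rw [e]
    field_simp
  rw [h4]
  gcongr

/-- From `log u ≤ u - 1`. It shows that the divergence is of second order along a segment leaving
`q`, which is the only smoothness of the entropy needed below. -/
theorem KL_le_sum_sq_div {p q : A → ℝ} (hp : p ∈ stdSimplex ℝ A) (hq : q ∈ posSimplex A) :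
    KL p q ≤ ∑ a, (p a - q a) ^ 2 / q a := by
  have h1 : ∑ a, (p a - q a) ^ 2 / q a = ∑ a, p a * (p a / q a - 1) - ∑ a, p a + ∑ a, q a := by
    rw [← Finset.sum_sub_distrib, ← Finset.sum_add_distrib]
    refine Finset.sum_congr rfl fun a _ => ?_
    have := (hq.2 a).ne'
    field_simp
    ring
  rw [h1, hp.2, hq.1.2, sub_add_cancel]
  refine Finset.sum_le_sum fun a _ => ?_
  rcases (hp.1 a).eq_or_lt with h0 | h0
  · simp [← h0]
  · exact mul_le_mul_of_nonneg_left (Real.log_le_sub_one_of_pos (div_pos h0 (hq.2 a))) h0.le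

/-- The negative entropy. -/
noncomputable def negEntropy (p : A → ℝ) : ℝ := ∑ a, p a * Real.log (p a)

theorem KL_eq_negEntropy_sub (p : A → ℝ) {q : A → ℝ} (hq : ∀ a, 0 < q a) :
    KL p q = negEntropy p - pair (fun a => Real.log (q a)) p := by
  rw [KL, negEntropy, pair, ← Finset.sum_sub_distrib]
  refine Finset.sum_congr rfl fun a _ => ?_
  by_cases h0 : p a = 0
  · simp [h0]
  · rw [Real.log_div h0 (hq a).ne']
    ring

theorem pair_add_left (g g' p : A → ℝ) : pair (g + g') p = pair g p + pair g' p := by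
  simp [pair, add_mul, Finset.sum_add_distrib]

theorem pair_smul_left (c : ℝ) (g p : A → ℝ) : pair (c • g) p = c * pair g p := by
  simp [pair, Finset.mul_sum, mul_assoc]

theorem pair_add_right (g p p' : A → ℝ) : pair g (p + p') = pair g p + pair g p' := by
  simp [pair, mul_add, Finset.sum_add_distrib]

theorem pair_sub_right (g p p' : A → ℝ) : pair g (p - p') = pair g p - pair g p' := by
  simp [pair, mul_sub, Finset.sum_sub_distrib]

theorem pair_sub_left (g g' p : A → ℝ) : pair (g - g') p = pair g p - pair g' p := by
  simp [pair, sub_mul, Finset.sum_sub_distrib]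

theorem pair_smul_right (c : ℝ) (g p : A → ℝ) : pair g (c • p) = c * pair g p := by
  simp only [pair, Finset.mul_sum, Pi.smul_apply, smul_eq_mul]
  exact Finset.sum_congr rfl fun a _ => by ring

theorem abs_pair_sub_le (g p p' : A → ℝ) {C : ℝ} (hC : ∀ a, |g a| ≤ C) :
    |pair g (p - p')| ≤ C * l1dist p p' := by
  rw [pair, l1dist, Finset.mul_sum]
  refine (Finset.abs_sum_le_sum_abs _ _).trans (Finset.sum_le_sum fun a _ => ?_)
  rw [abs_mul]
  exact mul_le_mul_of_nonneg_right (hC a) (abs_nonneg _)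

theorem l1dist_le_two {p q : A → ℝ} (hp : p ∈ stdSimplex ℝ A) (hq : q ∈ stdSimplex ℝ A) :
    l1dist p q ≤ 2 := by
  have : l1dist p q ≤ ∑ a, (p a + q a) := by
    refine Finset.sum_le_sum fun a _ => ?_
    have := hp.1 a
    have := hq.1 a
    rw [abs_le]
    constructor <;> linarith
  rw [Finset.sum_add_distrib, hp.2, hq.2] at this
  linarith

theorem l1dist_smul_add {ρ : ℝ} (hρ : 0 ≤ ρ) (y x x' : A → ℝ) :
    l1dist ((1 - ρ) • y + ρ • x') ((1 - ρ) • y + ρ • x) = ρ * l1dist x' x := by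
  rw [l1dist, l1dist, Finset.mul_sum]
  refine Finset.sum_congr rfl fun a _ => ?_
  have : ((1 - ρ) • y + ρ • x') a - ((1 - ρ) • y + ρ • x) a = ρ * (x' a - x a) := by
    simp; ring
  rw [this, abs_mul, abs_of_nonneg hρ]

theorem convex_posSimplex : Convex ℝ (posSimplex A) := by
  intro p hp q hq a b ha hb hab
  refine ⟨convex_stdSimplex ℝ A hp.1 hq.1 ha hb hab, fun i => ?_⟩
  have h1 := hp.2 i
  have h2 := hq.2 i
  simp only [Pi.add_apply, Pi.smul_apply, smul_eq_mul]
  rcases ha.eq_or_lt with h | h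
  · have : b = 1 := by linarith
    simpa [← h, this] using h2
  · have := mul_pos h h1
    have := mul_nonneg hb h2.le
    linarith

theorem KL_convex_left {p p' q : A → ℝ} (hp : ∀ a, 0 ≤ p a) (hp' : ∀ a, 0 ≤ p' a)
    (hq : ∀ a, 0 < q a) {a b : ℝ} (ha : 0 ≤ a) (hb : 0 ≤ b) (hab : a + b = 1) :
    KL (a • p + b • p') q ≤ a * KL p q + b * KL p' q := by
  rw [KL_eq_negEntropy_sub _ hq, KL_eq_negEntropy_sub _ hq, KL_eq_negEntropy_sub _ hq,
    pair_add_right, pair_smul_right, pair_smul_right]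
  have : negEntropy (a • p + b • p') ≤ a * negEntropy p + b * negEntropy p' := by
    rw [negEntropy, negEntropy, negEntropy, Finset.mul_sum, Finset.mul_sum,
      ← Finset.sum_add_distrib]
    exact Finset.sum_le_sum fun i _ =>
      Real.convexOn_mul_log.2 (Set.mem_Ici.2 (hp i)) (Set.mem_Ici.2 (hp' i)) ha hb hab
  linarith

/-- A positive minimizer over the simplex of a linear function plus a multiple of the negative
entropy satisfies the three-point inequality. -/
theorem add_mul_KL_le_of_isMinOn {w x : A → ℝ} {c : ℝ} (hc : 0 ≤ c) (hx : x ∈ posSimplex A)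
    (hmin : IsMinOn (fun p => pair w p + c * negEntropy p) (stdSimplex ℝ A) x)
    {p : A → ℝ} (hp : p ∈ stdSimplex ℝ A) :
    pair w x + c * negEntropy x + c * KL p x ≤ pair w p + c * negEntropy p := by
  set u : A → ℝ := fun a => Real.log (x a) with hu
  have hsub : ∀ q : A → ℝ, negEntropy q = negEntropy x + pair u (q - x) + KL q x := by
    intro q
    rw [KL_eq_negEntropy_sub q hx.2, pair_sub_right]
    have : pair u x = negEntropy x := by
      simp only [pair, negEntropy, hu]
      exact Finset.sum_congr rfl fun a _ => mul_comm _ _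
    rw [this]
    ring
  set K : ℝ := ∑ a, (p a - x a) ^ 2 / x a with hK
  have hK0 : 0 ≤ K := Finset.sum_nonneg fun a _ => div_nonneg (sq_nonneg _) (hx.2 a).le
  set s : ℝ := pair w (p - x) + c * pair u (p - x) with hs
  -- Minimality is tested on the segment from `x` to `p`. The entropy is its linearization at `x`
  -- plus a divergence of size at most `τ² K`, so dividing by `τ` leaves the directional derivative
  -- `s` plus a term linear in `τ`.
  have key : ∀ τ : ℝ, 0 < τ → τ ≤ 1 → 0 ≤ s + c * K * τ := by
    intro τ h0 h1
    set q : A → ℝ := (1 - τ) • x + τ • p with hq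
    have hqx : q - x = τ • (p - x) := by
      rw [hq]; module
    have hqm : q ∈ stdSimplex ℝ A :=
      convex_stdSimplex ℝ A hx.1 hp (by linarith) h0.le (by ring)
    have h2 : pair w x + c * negEntropy x ≤ pair w q + c * negEntropy q := hmin hqm
    have h3 : KL q x ≤ τ ^ 2 * K := by
      refine (KL_le_sum_sq_div hqm hx).trans_eq ?_
      rw [hK, Finset.mul_sum]
      refine Finset.sum_congr rfl fun a _ => ?_
      have : q a - x a = τ * (p a - x a) := congrFun hqx a
      rw [this]
      ring
    have h4 : pair w q = pair w x + τ * pair w (p - x) := by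
      rw [← pair_smul_right, ← hqx, pair_sub_right]
      ring
    rw [hsub q, h4, hqx, pair_smul_right] at h2
    have h5 := mul_le_mul_of_nonneg_left h3 hc
    have h6 : 0 ≤ τ * (s + c * K * τ) := by
      rw [hs]
      nlinarith
    exact nonneg_of_mul_nonneg_right h6 h0
  have hs0 : 0 ≤ s := by
    by_contra hneg
    push Not at hneg
    have hcK : 0 ≤ c * K := mul_nonneg hc hK0
    -- For this `τ` the linear term is at most `-s/2`, too small to compensate a negative `s`.
    have hτ : 0 < min 1 (-s / (2 * (c * K + 1))) :=
      lt_min one_pos (div_pos (by linarith) (by positivity))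
    have h1 := key _ hτ (min_le_left _ _)
    have h2 := mul_le_mul_of_nonneg_left (min_le_right 1 (-s / (2 * (c * K + 1)))) hcK
    have h3 : c * K * (-s / (2 * (c * K + 1))) ≤ -s / 2 := by
      rw [mul_div_assoc', div_le_div_iff₀ (by positivity) (by norm_num)]
      nlinarith
    linarith
  rw [hsub p]
  rw [hs, pair_sub_right w] at hs0
  linarith

theorem uniformPolicy_mem {S : Type*} [Nonempty A] (s : S) :
    uniformPolicy S A s ∈ posSimplex A := by
  have : (0 : ℝ) < Fintype.card A := by exact_mod_cast Fintype.card_pos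
  refine ⟨⟨fun a => ?_, ?_⟩, fun a => ?_⟩
  · simp only [uniformPolicy]; positivity
  · simp only [uniformPolicy, Finset.sum_const, Finset.card_univ, nsmul_eq_mul]
    field_simp
  · simp only [uniformPolicy]; positivity

theorem KL_uniformPolicy_le {S : Type*} [Nonempty A] (s : S) {p : A → ℝ}
    (hp : p ∈ stdSimplex ℝ A) : KL p (uniformPolicy S A s) ≤ Real.log (Fintype.card A) := by
  have hn : (0 : ℝ) < Fintype.card A := by exact_mod_cast Fintype.card_pos
  rw [KL_eq_negEntropy_sub p (uniformPolicy_mem s).2]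
  have h1 : negEntropy p ≤ 0 := Finset.sum_nonpos fun a _ =>
    Real.mul_log_nonpos (hp.1 a) (mem_Icc_of_mem_stdSimplex hp a).2
  have h2 : pair (fun a => Real.log (uniformPolicy S A s a)) p = -Real.log (Fintype.card A) := by
    simp only [pair, uniformPolicy, one_div, Real.log_inv]
    rw [← Finset.mul_sum, hp.2, mul_one]
  rw [h2]
  linarith

end Divergence

/-! ### One accelerated gradient step -/

section Descent

variable {A : Type*} [Fintype A]

/-- All divergences in the prox step share the same negative entropy, so the whole objective is
linear plus a multiple of it and the three-point inequality applies. -/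
theorem pair_entropy_objective (g z v x₀ p : A → ℝ) (r μφ : ℝ) (hz : ∀ a, 0 < z a)
    (hv : ∀ a, 0 < v a) (hx₀ : ∀ a, 0 < x₀ a) :
    r * (pair g p + μφ * KL p z + KL p v) + KL p x₀
      = pair (r • (g - μφ • (fun a => Real.log (z a)) - fun a => Real.log (v a))
          - fun a => Real.log (x₀ a)) p + (1 + r * (1 + μφ)) * negEntropy p := by
  rw [KL_eq_negEntropy_sub p hz, KL_eq_negEntropy_sub p hv, KL_eq_negEntropy_sub p hx₀,
    pair_sub_left, pair_smul_left, pair_sub_left, pair_sub_left, pair_smul_left]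
  ring

/-- One accelerated gradient step. -/
theorem agd_step {φ : (A → ℝ) → ℝ} {g v x y x' y' z : A → ℝ} {μφ Lφ r ρ : ℝ}
    (hμφ : 0 ≤ μφ) (hr : 0 < r) (hρ : 0 < ρ) (hρ1 : ρ ≤ 1) (hLρ : 2 * Lφ * (ρ * r) ≤ 1)
    (hv : v ∈ posSimplex A) (hx : x ∈ posSimplex A) (hy : y ∈ posSimplex A)
    (hx' : x' ∈ posSimplex A)
    (hz : z = (1 - ρ) • y + ρ • x) (hy' : y' = (1 - ρ) • y + ρ • x')
    (hstrong : ∀ p ∈ stdSimplex ℝ A, φ z + pair g (p - z) + μφ * KL p z ≤ φ p)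
    (hsmooth : φ y' ≤ φ z + pair g (y' - z) + Lφ * l1dist y' z ^ 2) (hLφ : 0 ≤ Lφ)
    (hmin : IsMinOn (fun p => r * (pair g p + μφ * KL p z + KL p v) + KL p x)
      (stdSimplex ℝ A) x')
    {p : A → ℝ} (hp : p ∈ stdSimplex ℝ A) :
    r * (φ y' + KL y' v - (φ p + KL p v)) + ρ * (1 + r * (1 + μφ)) * KL p x'
      ≤ r * ((1 - ρ) * (φ y + KL y v - (φ p + KL p v))) + ρ * KL p x := by
  have hzp : z ∈ posSimplex A := by
    rw [hz]; exact convex_posSimplex hy hx (by linarith) hρ.le (by ring)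
  have h3 := add_mul_KL_le_of_isMinOn (c := 1 + r * (1 + μφ)) (by positivity) hx'
    (w := r • (g - μφ • (fun a => Real.log (z a)) - fun a => Real.log (v a))
          - fun a => Real.log (x a)) (by
      refine hmin.congr ?_ ?_
      · exact fun q _ => pair_entropy_objective g z v x q r μφ hzp.2 hv.2 hx.2
      · exact pair_entropy_objective g z v x x' r μφ hzp.2 hv.2 hx.2) hp
  have e1 := pair_entropy_objective g z v x x' r μφ hzp.2 hv.2 hx.2
  have e2 := pair_entropy_objective g z v x p r μφ hzp.2 hv.2 hx.2
  have h3' : r * (pair g x' + μφ * KL x' z + KL x' v) + KL x' x + (1 + r * (1 + μφ)) * KL p x'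
      ≤ r * (pair g p + μφ * KL p z + KL p v) + KL p x := by
    rw [e1, e2]; exact h3
  have hd : l1dist y' z = ρ * l1dist x' x := by
    rw [hy', hz, l1dist_smul_add hρ.le]
  have hpin := sq_l1dist_le hx'.1 hx
  have hχ : KL y' v ≤ (1 - ρ) * KL y v + ρ * KL x' v := by
    rw [hy']
    exact KL_convex_left hy.1.1 hx'.1.1 hv.2 (by linarith) hρ.le (by ring)
  have hsy := hstrong y hy.1
  have hsp := hstrong p hp
  have hKy : 0 ≤ μφ * KL y z := mul_nonneg hμφ (KL_nonneg hy.1 hzp)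
  have hKx : 0 ≤ μφ * KL x' z := mul_nonneg hμφ (KL_nonneg hx'.1 hzp)
  have hKxx : 0 ≤ KL x' x := KL_nonneg hx'.1 hx
  have epy' : pair g y' = (1 - ρ) * pair g y + ρ * pair g x' := by
    rw [hy', pair_add_right, pair_smul_right, pair_smul_right]
  simp only [pair_sub_right] at hsmooth hsy hsp
  rw [hd] at hsmooth
  -- The quadratic smoothness error is paid by the prox divergence `KL x' x`, through Pinsker and
  -- the stepsize condition `hLρ`.
  have hq : r * (Lφ * (ρ * l1dist x' x) ^ 2) ≤ ρ * KL x' x := by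
    have h1 : r * (Lφ * (ρ * l1dist x' x) ^ 2) = (Lφ * (ρ * r)) * ρ * l1dist x' x ^ 2 := by ring
    rw [h1]
    have h2 : (Lφ * (ρ * r)) * ρ * l1dist x' x ^ 2 ≤ (Lφ * (ρ * r)) * ρ * (2 * KL x' x) := by
      gcongr
    nlinarith [mul_nonneg hρ.le hKxx, mul_le_mul_of_nonneg_right hLρ (mul_nonneg hρ.le hKxx)]
  have s1 := mul_le_mul_of_nonneg_left hsmooth hr.le
  have s2 := mul_le_mul_of_nonneg_left hχ hr.le
  have s3 := mul_le_mul_of_nonneg_left h3' hρ.le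
  have s4 := mul_le_mul_of_nonneg_left hsy (mul_nonneg hr.le (by linarith : 0 ≤ 1 - ρ))
  have s5 := mul_le_mul_of_nonneg_left hsp (mul_nonneg hr.le hρ.le)
  have s6 := mul_nonneg (mul_nonneg hr.le hρ.le) hKx
  have s7 := mul_nonneg (mul_nonneg hr.le (by linarith : 0 ≤ 1 - ρ)) hKy
  rw [epy'] at s1
  nlinarith

end Descent

/-! ### Weights, stepsizes and accuracy of the inner method -/

section Parameters

variable {Λ m : ℝ}

theorem sqrt_div_facts (hm : 0 < m) (hΛ : 4 * m ≤ Λ) :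
    0 < Real.sqrt (m / Λ) ∧ Real.sqrt (m / Λ) ≤ 1 / 2 ∧
      Real.sqrt (m / Λ) ^ 2 = m / Λ ∧ Real.sqrt (Λ / m) = 1 / Real.sqrt (m / Λ) ∧
      Real.sqrt (Λ * m) = m / Real.sqrt (m / Λ) := by
  have hΛ0 : 0 < Λ := by linarith
  have hα : 0 < Real.sqrt (m / Λ) := Real.sqrt_pos.2 (by positivity)
  have hsq : Real.sqrt (m / Λ) ^ 2 = m / Λ := Real.sq_sqrt (by positivity)
  refine ⟨hα, ?_, hsq, ?_, ?_⟩
  · rw [Real.sqrt_le_left (by norm_num), div_le_iff₀ hΛ0]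
    linarith
  · rw [one_div, ← Real.sqrt_inv, inv_div]
  · rw [eq_div_iff hα.ne', ← Real.sqrt_mul (by positivity)]
    have : Λ * m * (m / Λ) = m ^ 2 := by field_simp
    rw [this, Real.sqrt_sq hm.le]

/-- The switch occurs where the decreasing weight `2/(t+1)` would fall below `√(m/Λ)`; hence the
weights never go below that value. -/
theorem le_agdSwitch_iff (hm : 0 < m) (hΛ : 4 * m ≤ Λ) (t : ℕ) :
    t ≤ agdSwitch Λ m ↔ ((t : ℝ) + 1) * Real.sqrt (m / Λ) ≤ 2 := by
  obtain ⟨hα, hα2, -, he, -⟩ := sqrt_div_facts hm hΛ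
  have h2 : 2 ≤ 1 / Real.sqrt (m / Λ) := by
    rw [le_div_iff₀ hα]; linarith
  rw [agdSwitch, Nat.le_floor_iff (by rw [he]; linarith), he, ← le_div_iff₀ hα]
  constructor <;> intro h <;> ring_nf at h ⊢ <;> linarith

theorem agdWeight_mem (hm : 0 < m) (hΛ : 4 * m ≤ Λ) {t : ℕ} (ht : 1 ≤ t) :
    Real.sqrt (m / Λ) ≤ agdWeight Λ m t ∧ agdWeight Λ m t ≤ 1 := by
  obtain ⟨hα, hα2, -, -, -⟩ := sqrt_div_facts hm hΛ
  have ht' : (1 : ℝ) ≤ t := by exact_mod_cast ht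
  rw [agdWeight]
  split_ifs with h
  · rw [le_agdSwitch_iff hm hΛ] at h
    constructor
    · rw [le_div_iff₀ (by positivity)]; linarith
    · rw [div_le_one (by positivity)]; linarith
  · exact ⟨le_rfl, by linarith⟩

/-- The product is `t/(Λ(t+1))` before the switch and `1/(Λ(1-α))` after it, with `α = √(m/Λ) ≤
1/2`. Together with `4 Lφ ≤ Λ` it yields the stepsize condition of `agd_step`. -/
theorem agdWeight_mul_agdStepsize_le (hm : 0 < m) (hΛ : 4 * m ≤ Λ) {t : ℕ} (ht : 1 ≤ t) :
    0 < agdStepsize Λ m t ∧ agdWeight Λ m t * agdStepsize Λ m t ≤ 2 / Λ := by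
  obtain ⟨hα, hα2, hsq, -, he⟩ := sqrt_div_facts hm hΛ
  have hΛ0 : 0 < Λ := by linarith
  have ht' : (1 : ℝ) ≤ t := by exact_mod_cast ht
  rw [agdWeight, agdStepsize]
  split_ifs with h
  · refine ⟨by positivity, ?_⟩
    rw [div_mul_div_comm, div_le_div_iff₀ (by positivity) hΛ0]
    nlinarith
  · rw [he]
    set α := Real.sqrt (m / Λ)
    have e : m / α - m = m * (1 - α) / α := by field_simp
    have h1 : 0 < 1 - α := by linarith
    rw [e]
    refine ⟨by positivity, ?_⟩
    have hm' : m = α ^ 2 * Λ := by rw [hsq]; field_simp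
    have e2 : α * (1 / (m * (1 - α) / α)) = 1 / (Λ * (1 - α)) := by
      rw [hm']; field_simp
    rw [e2, div_le_div_iff₀ (by positivity) hΛ0]
    nlinarith

/-- Passing from `t` to `t + 1` multiplies the left side by `t/(t+2)`, which is at most `1 - √(m/Λ)`
as long as `t + 1` does not exceed the switching index. Thus the minimum in the accuracy is the
polynomial term there. -/
theorem two_div_le_pow (hm : 0 < m) (hΛ : 4 * m ≤ Λ) {t : ℕ} (ht : 1 ≤ t)
    (hts : t ≤ agdSwitch Λ m) :
    2 / ((t : ℝ) * ((t : ℝ) + 1)) ≤ (1 - Real.sqrt (m / Λ)) ^ (t - 1) := by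
  obtain ⟨hα, hα2, -, -, -⟩ := sqrt_div_facts hm hΛ
  induction t, ht using Nat.le_induction with
  | base => norm_num
  | succ t ht ih =>
    have h1 := ih (by omega)
    rw [le_agdSwitch_iff hm hΛ] at hts
    push_cast at hts ⊢
    have ht' : (1 : ℝ) ≤ t := by exact_mod_cast ht
    set α := Real.sqrt (m / Λ)
    have h2 : (t : ℝ) / (t + 2) ≤ 1 - α := by
      rw [div_le_iff₀ (by positivity)]; linarith
    have h3 : (1 - α) ^ t = (1 - α) ^ (t - 1) * (1 - α) := by
      rw [← pow_succ]; congr 1; omega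
    have h4 : 2 / (((t : ℝ) + 1) * ((t : ℝ) + 1 + 1))
        = 2 / ((t : ℝ) * ((t : ℝ) + 1)) * (t / (t + 2)) := by
      field_simp; ring
    rw [h3, h4]
    exact mul_le_mul h1 h2 (by positivity) (pow_nonneg (by linarith) _)

theorem agdAccuracy_of_le_switch (hm : 0 < m) (hΛ : 4 * m ≤ Λ) {t : ℕ} (ht : 1 ≤ t)
    (hts : t ≤ agdSwitch Λ m) :
    agdAccuracy Λ m t = 4 * Λ / ((t : ℝ) * ((t : ℝ) + 1)) := by
  rw [agdAccuracy, min_eq_right (two_div_le_pow hm hΛ ht hts)]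
  ring

/-- Beyond the switch `t/(t+2)` exceeds `1 - √(m/Λ)`, so neither entry of the minimum decreases
faster than the linear rate of the method. -/
theorem mul_agdAccuracy_le_succ (hm : 0 < m) (hΛ : 4 * m ≤ Λ) {t : ℕ} (ht : 1 ≤ t)
    (hts : ¬ t + 1 ≤ agdSwitch Λ m) :
    (1 - Real.sqrt (m / Λ)) * agdAccuracy Λ m t ≤ agdAccuracy Λ m (t + 1) := by
  obtain ⟨hα, hα2, -, -, -⟩ := sqrt_div_facts hm hΛ
  have hΛ0 : 0 < Λ := by linarith
  have ht' : (1 : ℝ) ≤ t := by exact_mod_cast ht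
  rw [le_agdSwitch_iff hm hΛ] at hts
  push_cast at hts
  set α := Real.sqrt (m / Λ) with hαd
  have h1α : 0 ≤ 1 - α := by linarith
  rw [agdAccuracy, agdAccuracy, mul_left_comm, mul_min_of_nonneg _ _ h1α]
  refine mul_le_mul_of_nonneg_left (min_le_min ?_ ?_) (by positivity)
  · rw [← pow_succ', ← hαd]
    exact le_of_eq (by congr 1; omega)
  · have h2 : 1 - α ≤ (t : ℝ) / (t + 2) := by
      rw [le_div_iff₀ (by positivity)]; linarith
    have h4 : 2 / (((t + 1 : ℕ) : ℝ) * (((t + 1 : ℕ) : ℝ) + 1))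
        = (t / (t + 2)) * (2 / ((t : ℝ) * ((t : ℝ) + 1))) := by
      push_cast
      field_simp; ring
    rw [h4]
    exact mul_le_mul_of_nonneg_right h2 (by positivity)

end Parameters

/-! ### Solving the accelerated recursion -/

section Convergence

variable {m Λ : ℝ} {T : ℕ} {δ D : ℕ → ℝ}

/-- The recursion of the accelerated gradient method, solved. -/
theorem agd_recursion (hm : 0 < m) (hΛ : 4 * m ≤ Λ) (hD : ∀ t ≤ T, 0 ≤ D t)
    (hstep : ∀ t < T, agdStepsize Λ m (t + 1) * δ (t + 1)
        + agdWeight Λ m (t + 1) * (1 + agdStepsize Λ m (t + 1) * m) * D (t + 1)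
      ≤ agdStepsize Λ m (t + 1) * ((1 - agdWeight Λ m (t + 1)) * δ t)
        + agdWeight Λ m (t + 1) * D t) :
    ∀ t, 1 ≤ t → t ≤ T → δ t + m * D t ≤ agdAccuracy Λ m t * D 0 := by
  obtain ⟨hα, hα2, hsq, -, he⟩ := sqrt_div_facts hm hΛ
  have hΛ0 : 0 < Λ := by linarith
  -- Polynomial phase: the step inequality is multiplied by `2Λ(t+2)`, so that the coefficients of
  -- `δ` telescope.
  have phase1 : ∀ t, t ≤ T → t ≤ agdSwitch Λ m →
      (t : ℝ) * (t + 1) * δ t + (4 * Λ + 2 * t * m) * D t ≤ 4 * Λ * D 0 := by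
    intro t
    induction t with
    | zero => simp
    | succ t ih =>
      intro hT hs
      have h1 := ih (by omega) (by omega)
      have h2 := hstep t (by omega)
      rw [agdStepsize, agdWeight, if_pos hs, if_pos hs] at h2
      push_cast at h2 ⊢
      have h3 := mul_le_mul_of_nonneg_left h2 (by positivity : 0 ≤ 2 * Λ * ((t : ℝ) + 2))
      have e1 : 2 * Λ * ((t : ℝ) + 2) * (((t : ℝ) + 1) / (2 * Λ) * δ (t + 1)
          + 2 / ((t : ℝ) + 1 + 1) * (1 + ((t : ℝ) + 1) / (2 * Λ) * m) * D (t + 1))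
          = ((t : ℝ) + 1) * (t + 2) * δ (t + 1) + (4 * Λ + 2 * (t + 1) * m) * D (t + 1) := by
        field_simp; ring
      have e2 : 2 * Λ * ((t : ℝ) + 2) * (((t : ℝ) + 1) / (2 * Λ)
          * ((1 - 2 / ((t : ℝ) + 1 + 1)) * δ t) + 2 / ((t : ℝ) + 1 + 1) * D t)
          = (t : ℝ) * (t + 1) * δ t + 4 * Λ * D t := by
        field_simp; ring
      rw [e1, e2] at h3
      have h4 : 0 ≤ 2 * (t : ℝ) * m * D t := mul_nonneg (by positivity) (hD t (by omega))
      have h5 : ((t : ℝ) + 1) * (t + 1 + 1) = ((t : ℝ) + 1) * (t + 2) := by ring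
      rw [h5]
      linarith
  intro t ht
  induction t, ht using Nat.le_induction with
  | base =>
    intro hT
    -- The first iteration always lies in the polynomial phase, since `2√(m/Λ) ≤ 1`.
    have hs : 1 ≤ agdSwitch Λ m := by
      rw [le_agdSwitch_iff hm hΛ]; push_cast; linarith
    have h1 := phase1 1 hT hs
    rw [agdAccuracy_of_le_switch hm hΛ le_rfl hs]
    push_cast at h1 ⊢
    have := mul_nonneg hΛ0.le (hD 1 hT)
    nlinarith
  | succ t ht ih =>
    intro hT
    by_cases hs : t + 1 ≤ agdSwitch Λ m
    · have h1 := phase1 (t + 1) hT hs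
      rw [agdAccuracy_of_le_switch hm hΛ (by omega) hs, div_mul_eq_mul_div,
        le_div_iff₀ (by positivity)]
      rw [le_agdSwitch_iff hm hΛ] at hs
      push_cast at h1 hs ⊢
      -- Before the switch `(t+2)² m ≤ 4Λ`, so the coefficient of `D` left by the polynomial phase
      -- covers the required `m`.
      have h2 : (((t : ℝ) + 1) * (t + 1 + 1)) * m ≤ 4 * Λ + 2 * (t + 1) * m := by
        have h3 : (((t : ℝ) + 1 + 1) * Real.sqrt (m / Λ)) ^ 2 ≤ 2 ^ 2 :=
          pow_le_pow_left₀ (by positivity) hs 2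
        rw [mul_pow, hsq, mul_div_assoc', div_le_iff₀ hΛ0] at h3
        nlinarith
      have h4 := mul_le_mul_of_nonneg_right h2 (hD (t + 1) hT)
      nlinarith
    · have h1 := ih (by omega)
      have h2 := hstep t (by omega)
      have hacc := mul_agdAccuracy_le_succ hm hΛ ht hs
      rw [agdStepsize, agdWeight, if_neg hs, if_neg hs, he] at h2
      set α := Real.sqrt (m / Λ)
      have h1α : 0 < 1 - α := by linarith
      have e : 1 / (m / α - m) = α / (m * (1 - α)) := by field_simp
      rw [e] at h2
      -- Linear phase: after scaling by `1/r`, the quantity `δ + m D` contracts exactly by `1 - α`.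
      have h3 := mul_le_mul_of_nonneg_left h2
        (by positivity : 0 ≤ m * (1 - α) / α)
      have e1 : m * (1 - α) / α * (α / (m * (1 - α)) * δ (t + 1)
          + α * (1 + α / (m * (1 - α)) * m) * D (t + 1)) = δ (t + 1) + m * D (t + 1) := by
        field_simp; ring
      have e2 : m * (1 - α) / α * (α / (m * (1 - α)) * ((1 - α) * δ t) + α * D t)
          = (1 - α) * (δ t + m * D t) := by
        field_simp
      rw [e1, e2] at h3
      have h4 := mul_le_mul_of_nonneg_left h1 h1α.le
      have h5 := mul_le_mul_of_nonneg_right hacc (hD 0 (by omega))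
      calc _ ≤ _ := h3
        _ ≤ _ := h4
        _ = (1 - α) * agdAccuracy Λ m t * D 0 := by ring
        _ ≤ _ := h5

end Convergence

/-! ### Accuracy of the inner method -/

section Accuracy

variable {A : Type*} [Fintype A]

/-- Convexity at `y` bounds `φ y - φ z` by the gradient at `y`, and the Lipschitz bound moves the
gradient to `z`. No integration along the segment is needed; the price is the constant `Lφ` instead
of `Lφ/2`. -/
theorem le_add_sq_of_lipschitz {φ : (A → ℝ) → ℝ} {g : (A → ℝ) → (A → ℝ)} {μφ Lφ : ℝ}
    {y z : A → ℝ} (hμφ : 0 ≤ μφ) (hy : y ∈ posSimplex A) (hz : z ∈ stdSimplex ℝ A)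
    (hstrong : φ y + pair (g y) (z - y) + μφ * KL z y ≤ φ z)
    (hlip : ∀ a, |g y a - g z a| ≤ Lφ * l1dist y z) :
    φ y ≤ φ z + pair (g z) (y - z) + Lφ * l1dist y z ^ 2 := by
  have h1 := (le_abs_self _).trans (abs_pair_sub_le (g y - g z) y z hlip)
  have h2 := mul_nonneg hμφ (KL_nonneg hz hy)
  rw [pair_sub_left] at h1
  simp only [pair_sub_right] at *
  nlinarith

theorem IsAGD.step_mem {gφ : (A → ℝ) → (A → ℝ)} {μφ Λ m : ℝ} {χ : (A → ℝ) → ℝ} {start : A → ℝ}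
    {T : ℕ} {x y : ℕ → A → ℝ} {r : ℕ → ℝ} (hm : 0 < m) (hΛ : 4 * m ≤ Λ)
    (h : IsAGD gφ μφ χ (agdWeight Λ m) r (agdWeight Λ m) start T x y)
    (hs : start ∈ stdSimplex ℝ A) :
    ∀ t ≤ T, x t ∈ stdSimplex ℝ A ∧ y t ∈ stdSimplex ℝ A := by
  intro t
  induction t with
  | zero => exact fun _ => ⟨h.x_zero ▸ hs, h.y_zero ▸ hs⟩
  | succ t ih =>
    intro ht
    obtain ⟨-, hy⟩ := ih (by omega)
    have hx' := h.x_mem t (by omega)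
    refine ⟨hx', ?_⟩
    obtain ⟨h1, h2⟩ := agdWeight_mem hm hΛ (Nat.le_add_left 1 t)
    have h3 := (sqrt_div_facts hm hΛ).1
    rw [h.y_step t (by omega)]
    exact convex_stdSimplex ℝ A hy hx' (by linarith) (by linarith) (by ring)

/-- Convergence of the accelerated gradient method, including the distance to its last
prox-iterate. -/
theorem IsAGD.accuracy {φ : (A → ℝ) → ℝ} {gφ : (A → ℝ) → (A → ℝ)} {μφ Lφ Λ m : ℝ} {v start : A → ℝ}
    {T : ℕ} {x y : ℕ → A → ℝ} {R : Set (A → ℝ)} (hμφ : 0 ≤ μφ) (hmμ : m = 1 + μφ)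
    (hΛ : 4 * m ≤ Λ) (hLφ : 0 ≤ Lφ) (hLΛ : 4 * Lφ ≤ Λ)
    (h : IsAGD gφ μφ (fun p => KL p v) (agdWeight Λ m) (agdStepsize Λ m) (agdWeight Λ m) start T x y)
    (hv : v ∈ posSimplex A) (hRp : R ⊆ posSimplex A) (hRc : Convex ℝ R)
    (hR : ∀ t ≤ T, x t ∈ R ∧ y t ∈ R)
    (hstrong : ∀ p ∈ stdSimplex ℝ A, ∀ p' ∈ posSimplex A,
      φ p' + pair (gφ p') (p - p') + μφ * KL p p' ≤ φ p)
    (hlip : ∀ p ∈ R, ∀ p' ∈ R, ∀ a, |gφ p a - gφ p' a| ≤ Lφ * l1dist p p')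
    {p : A → ℝ} (hp : p ∈ stdSimplex ℝ A) (hT : 1 ≤ T) :
    φ (y T) + KL (y T) v - (φ p + KL p v) + m * KL p (x T)
      ≤ agdAccuracy Λ m T * KL p start := by
  have hm : 0 < m := by linarith
  have hΛ0 : 0 < Λ := by linarith
  have hα := (sqrt_div_facts hm hΛ).1
  have key := agd_recursion (T := T) (δ := fun t => φ (y t) + KL (y t) v - (φ p + KL p v))
    (D := fun t => KL p (x t)) hm hΛ (fun t ht => KL_nonneg hp (hRp (hR t ht).1)) ?_ T hT le_rfl
  · simpa only [h.x_zero] using key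
  intro t ht
  obtain ⟨hw1, hw2⟩ := agdWeight_mem hm hΛ (Nat.le_add_left 1 t)
  obtain ⟨hr, hwr⟩ := agdWeight_mul_agdStepsize_le hm hΛ (Nat.le_add_left 1 t)
  obtain ⟨hx, hy⟩ := hR t ht.le
  obtain ⟨hx', hy'⟩ := hR (t + 1) ht
  have hzR : (1 - agdWeight Λ m (t + 1)) • y t + agdWeight Λ m (t + 1) • x t ∈ R :=
    hRc hy hx (by linarith) (by linarith) (by ring)
  rw [hmμ] at *
  refine agd_step (g := gφ _) hμφ hr (by linarith) hw2 ?_ hv (hRp hx) (hRp hy) (hRp hx') rfl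
    (h.y_step t ht) (fun q hq => hstrong q hq _ (hRp hzR)) ?_ hLφ (h.x_step t ht _ rfl) hp
  · have h1 := mul_le_mul_of_nonneg_left hwr (by linarith : 0 ≤ 2 * Lφ)
    refine h1.trans ?_
    rw [mul_div_assoc', div_le_one hΛ0]
    linarith
  · exact le_add_sq_of_lipschitz hμφ (hRp hy') (hRp hzR).1 (hstrong _ (hRp hzR).1 _ (hRp hy'))
      (hlip _ hy' _ hzR)

/-- The last averaging step gives `x T` a weight of at least `√(m/Λ)`, and the remaining summand is
nonnegative. -/
theorem IsAGD.last_ge {gφ : (A → ℝ) → (A → ℝ)} {μφ Λ m : ℝ} {χ : (A → ℝ) → ℝ} {start : A → ℝ}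
    {T : ℕ} {x y : ℕ → A → ℝ} {r : ℕ → ℝ} (hm : 0 < m) (hΛ : 4 * m ≤ Λ)
    (h : IsAGD gφ μφ χ (agdWeight Λ m) r (agdWeight Λ m) start T x y)
    (hs : start ∈ stdSimplex ℝ A) (hT : 1 ≤ T) (a : A) :
    Real.sqrt (m / Λ) * x T a ≤ y T a := by
  obtain ⟨t, rfl⟩ : ∃ t, T = t + 1 := ⟨T - 1, by omega⟩
  have hy := (h.step_mem hm hΛ hs t (by omega)).2.1 a
  have hx' := (h.x_mem t (by omega)).1 a
  obtain ⟨hw1, hw2⟩ := agdWeight_mem hm hΛ hT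
  rw [h.y_step t (by omega)]
  simp only [Pi.add_apply, Pi.smul_apply, smul_eq_mul]
  have h1 := mul_nonneg (by linarith : 0 ≤ 1 - agdWeight Λ m (t + 1)) hy
  have h2 := mul_le_mul_of_nonneg_right hw1 hx'
  linarith

end Accuracy

/-! ### Comparing divergences from two nearby distributions -/

section Comparison

open InformationTheory (klFun)

/-- Fenchel–Young: the conjugate of `klFun` is `exp - 1`. The defect is `c exp(-t/c)` times `klFun`
of the ratio of `p` to the optimal point `exp(-t/c)`. -/
theorem neg_mul_le_klFun {p c : ℝ} (hp : 0 ≤ p) (hc : 0 < c) (t : ℝ) :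
    -(p * t) ≤ c * klFun p + c * (Real.exp (-t / c) - 1) := by
  have h1 : 0 ≤ klFun (p / Real.exp (-t / c)) :=
    InformationTheory.klFun_nonneg (by positivity)
  have h2 : Real.exp (-t / c) * klFun (p / Real.exp (-t / c))
      = p * Real.log p + p * t / c + Real.exp (-t / c) - p := by
    rw [InformationTheory.klFun_apply]
    have he := (Real.exp_pos (-t / c)).ne'
    rcases hp.eq_or_lt with h0 | h0
    · simp [← h0]
    · rw [Real.log_div h0.ne' he, Real.log_exp]
      field_simp
      ring
  have h3 : 0 ≤ c * (Real.exp (-t / c) * klFun (p / Real.exp (-t / c))) := by positivity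
  rw [h2] at h3
  rw [InformationTheory.klFun_apply]
  have h4 : c * (p * t / c) = p * t := by field_simp
  nlinarith

/-- With `y = exp(-s)`, the lower bound on `y` says `s ≤ c - 1`, so `exp(s/c)` has a quadratic
expansion. Both sides are then compared with multiples of `s²`; the factor `1 + c` absorbs the
growth of `exp(-s)`-weighted terms as `s` grows. -/
theorem sub_one_add_exp_le_klFun {y c : ℝ} (hc : 1 ≤ c) (hy : Real.exp (1 - c) ≤ y) (hy1 : y < 1) :
    y - 1 + c * (Real.exp (-Real.log y / c) - 1) ≤ 2 * (1 + c) * klFun y := by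
  have hy0 : 0 < y := (Real.exp_pos _).trans_le hy
  obtain ⟨s, rfl⟩ : ∃ s, y = Real.exp (-s) := ⟨-Real.log y, by rw [neg_neg, Real.exp_log hy0]⟩
  rw [Real.exp_le_exp] at hy
  have hs0 : 0 < s := by
    have := Real.exp_lt_one_iff.1 hy1
    linarith
  have hsc : s ≤ c - 1 := by linarith
  rw [InformationTheory.klFun_apply, Real.log_exp, neg_neg]
  have h1 : Real.exp (s / c) - 1 ≤ s / c + (s / c) ^ 2 := by
    have h0 : |s / c| ≤ 1 := by
      rw [abs_of_nonneg (by positivity), div_le_one (by positivity)]; linarith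
    have := (abs_le.1 (Real.abs_exp_sub_one_sub_id_le h0)).2
    linarith
  have h2 : c * (Real.exp (s / c) - 1) ≤ s + s ^ 2 / (1 + s) := by
    refine (mul_le_mul_of_nonneg_left h1 (by linarith)).trans ?_
    have e : c * (s / c + (s / c) ^ 2) = s + s ^ 2 / c := by field_simp
    rw [e]
    gcongr
    linarith
  have h3 : Real.exp (-s) ≤ 1 / (1 + s + s ^ 2 / 2) := by
    rw [Real.exp_neg, ← one_div]
    exact one_div_le_one_div_of_le (by positivity) (Real.quadratic_le_exp_of_nonneg hs0.le)
  have h4 : Real.exp (-s) ≤ 1 / (1 + s) :=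
    h3.trans (one_div_le_one_div_of_le (by positivity) (by nlinarith))
  have h5 : Real.exp (-s) - 1 + c * (Real.exp (s / c) - 1) ≤ 2 * (s ^ 2 / (1 + s)) := by
    have : 1 / (1 + s) - 1 + s = s ^ 2 / (1 + s) := by field_simp; ring
    linarith
  have h6 : s ^ 2 / (2 + 2 * s + s ^ 2) ≤ Real.exp (-s) * -s + 1 - Real.exp (-s) := by
    have h7 := mul_le_mul_of_nonneg_right h3 (by linarith : 0 ≤ 1 + s)
    have h8 : 1 - 1 / (1 + s + s ^ 2 / 2) * (1 + s) = s ^ 2 / (2 + 2 * s + s ^ 2) := by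
      field_simp; ring
    linarith
  refine h5.trans ((?_ : _ ≤ 2 * (1 + c) * (s ^ 2 / (2 + 2 * s + s ^ 2))).trans
    (mul_le_mul_of_nonneg_left h6 (by linarith)))
  rw [mul_assoc 2]
  refine mul_le_mul_of_nonneg_left ?_ (by norm_num)
  rw [mul_div_assoc', div_le_div_iff₀ (by positivity) (by positivity)]
  have h9 : 2 + 2 * s + s ^ 2 ≤ (1 + c) * (1 + s) := by nlinarith
  nlinarith [mul_le_mul_of_nonneg_left h9 (sq_nonneg s)]

theorem sq_sub_one_div_le_klFun {y : ℝ} (hy : 1 ≤ y) : (y - 1) ^ 2 / y ≤ 2 * klFun y := by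
  have h1 := three_mul_sq_div_le_klFun (by linarith : 0 ≤ y)
  have h2 : (y - 1) ^ 2 / y ≤ 2 * (3 / 2 * (y - 1) ^ 2 / (y + 2)) := by
    rw [mul_div_assoc', div_le_div_iff₀ (by linarith) (by linarith)]
    nlinarith [mul_nonneg (sq_nonneg (y - 1)) (by linarith : 0 ≤ y - 1)]
  linarith

theorem mul_log_div_le_klFun {p y c : ℝ} (hp : 0 ≤ p) (hc : 1 ≤ c) (hy : Real.exp (1 - c) ≤ y) :
    p * Real.log (p / y) - p + y ≤ (1 + c) * klFun p + 2 * (1 + c) * klFun y := by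
  have hy0 : 0 < y := (Real.exp_pos _).trans_le hy
  have hkp := InformationTheory.klFun_nonneg hp
  have hky := InformationTheory.klFun_nonneg hy0.le
  have e : p * Real.log (p / y) - p + y = klFun p + (y - 1) + -(p * Real.log y) := by
    rw [InformationTheory.klFun_apply]
    rcases hp.eq_or_lt with h0 | h0
    · simp [← h0]
    · rw [Real.log_div h0.ne' hy0.ne']
      ring
  rw [e]
  -- Only for `y < 1` is the logarithm large, and Fenchel–Young is used with parameter `c`; for `y ≥
  -- 1` parameter 1 suffices.
  rcases lt_or_ge y 1 with h1 | h1
  · have h2 := neg_mul_le_klFun hp (by linarith : 0 < c) (Real.log y)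
    have h3 := sub_one_add_exp_le_klFun hc hy h1
    linarith
  · have h2 := neg_mul_le_klFun hp one_pos (Real.log y)
    have h3 := sq_sub_one_div_le_klFun h1
    have h4 : Real.exp (-Real.log y / 1) = 1 / y := by
      rw [div_one, Real.exp_neg, Real.exp_log hy0, one_div]
    have h5 : (y - 1) ^ 2 / y = y - 1 + (1 / y - 1) := by field_simp; ring
    rw [h4] at h2
    nlinarith [mul_nonneg (by linarith : 0 ≤ c - 1) hkp, mul_nonneg (by linarith : 0 ≤ c) hky]

variable {A : Type*} [Fintype A]

/-- If `y ≥ ρ x`, then the divergence from `y` is controlled by the divergences from `x`, at the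
price of a factor logarithmic in `1/ρ`. -/
theorem KL_le_of_mul_le {p x y : A → ℝ} {ρ : ℝ} (hp : p ∈ stdSimplex ℝ A) (hx : x ∈ posSimplex A)
    (hy : y ∈ posSimplex A) (hρ : 0 < ρ) (hρ1 : ρ ≤ 1) (h : ∀ a, ρ * x a ≤ y a) :
    KL p y ≤ (2 - Real.log ρ) * KL p x + 2 * (2 - Real.log ρ) * KL y x := by
  have hlog := Real.log_nonpos hρ.le hρ1
  rw [KL_eq_sum_klFun hp hx, KL_eq_sum_klFun hy.1 hx]
  have e : KL p y = ∑ a, (p a * Real.log (p a / y a) - p a + y a) := by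
    rw [Finset.sum_add_distrib, Finset.sum_sub_distrib, hp.2, hy.1.2, KL]
    ring
  rw [e, Finset.mul_sum, Finset.mul_sum, ← Finset.sum_add_distrib]
  refine Finset.sum_le_sum fun a _ => ?_
  have hxa := hx.2 a
  -- The scalar inequality is applied to the ratios to `x`; the choice `c = 1 - log ρ` makes `exp(1
  -- - c) = ρ`.
  have h1 := mul_log_div_le_klFun (p := p a / x a) (y := y a / x a) (c := 1 - Real.log ρ)
    (div_nonneg (hp.1 a) hxa.le) (by linarith) (by
      rw [sub_sub_cancel, Real.exp_log hρ, le_div_iff₀ hxa]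
      exact h a)
  rw [div_div_div_cancel_right₀ hxa.ne'] at h1
  have h2 := mul_le_mul_of_nonneg_left h1 hxa.le
  have h3 : x a * (p a / x a * Real.log (p a / y a) - p a / x a + y a / x a)
      = p a * Real.log (p a / y a) - p a + y a := by field_simp
  rw [h3] at h2
  refine h2.trans_eq ?_
  ring

end Comparison

/-! ### Bellman equations and performance difference -/

section Value

variable {S A : Type*} [Fintype S] [Fintype A] {M : MDP S A} {h : S → (A → ℝ) → ℝ}
  {π π' : S → A → ℝ}

theorem abs_stepOp_le (hπ : IsPolicy π) {g : S → ℝ} {C : ℝ} (hg : ∀ s, |g s| ≤ C) (s : S) :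
    |stepOp M π g s| ≤ C := by
  have h1 : ∀ a, |∑ s', M.P s a s' * g s'| ≤ C := fun a => by
    calc |∑ s', M.P s a s' * g s'| ≤ ∑ s', |M.P s a s' * g s'| := Finset.abs_sum_le_sum_abs _ _
      _ ≤ ∑ s', M.P s a s' * C := Finset.sum_le_sum fun s' _ => by
        rw [abs_mul, abs_of_nonneg ((M.P_mem s a).1 s')]
        exact mul_le_mul_of_nonneg_left (hg s') ((M.P_mem s a).1 s')
      _ = C := by rw [← Finset.sum_mul, (M.P_mem s a).2, one_mul]
  calc |stepOp M π g s| ≤ ∑ a, |π s a * ∑ s', M.P s a s' * g s'| := Finset.abs_sum_le_sum_abs _ _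
    _ ≤ ∑ a, π s a * C := Finset.sum_le_sum fun a _ => by
      rw [abs_mul, abs_of_nonneg ((hπ s).1 a)]
      exact mul_le_mul_of_nonneg_left (h1 a) ((hπ s).1 a)
    _ = C := by rw [← Finset.sum_mul, (hπ s).2, one_mul]

theorem stepOp_le (hπ : IsPolicy π) {g : S → ℝ} {C : ℝ} (hg : ∀ s, g s ≤ C) (s : S) :
    stepOp M π g s ≤ C := by
  calc stepOp M π g s ≤ ∑ a, π s a * ∑ s', M.P s a s' * C := Finset.sum_le_sum fun a _ =>
        mul_le_mul_of_nonneg_left (Finset.sum_le_sum fun s' _ =>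
          mul_le_mul_of_nonneg_left (hg s') ((M.P_mem s a).1 s')) ((hπ s).1 a)
    _ = C := by simp_rw [← Finset.sum_mul, (M.P_mem s _).2, one_mul, ← Finset.sum_mul, (hπ s).2,
      one_mul]

theorem stepOp_sub (g g' : S → ℝ) (s : S) :
    stepOp M π (fun s => g s - g' s) s = stepOp M π g s - stepOp M π g' s := by
  simp only [stepOp, mul_sub, Finset.sum_sub_distrib]

theorem abs_iterate_stepOp_le (hπ : IsPolicy π) {g : S → ℝ} {C : ℝ} (hg : ∀ s, |g s| ≤ C)
    (t : ℕ) (s : S) : |(stepOp M π)^[t] g s| ≤ C := by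
  induction t generalizing s with
  | zero => exact hg s
  | succ t ih =>
    rw [Function.iterate_succ_apply']
    exact abs_stepOp_le hπ ih s

theorem exists_bound (g : S → ℝ) : ∃ C, ∀ s, |g s| ≤ C :=
  ⟨∑ s, |g s|, fun s => Finset.single_le_sum (f := fun s => |g s|)
    (fun _ _ => abs_nonneg _) (Finset.mem_univ s)⟩

theorem summable_value_of_bound (hπ : IsPolicy π) {C : ℝ}
    (hC : ∀ s, |stageCost M h π s| ≤ C) (s : S) :
    Summable (fun t : ℕ => M.γ ^ t * (stepOp M π)^[t] (stageCost M h π) s) := by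
  refine Summable.of_norm_bounded
    ((summable_geometric_of_lt_one M.γ_pos.le M.γ_lt_one).mul_right C) fun t => ?_
  rw [Real.norm_eq_abs, abs_mul, abs_of_nonneg (pow_nonneg M.γ_pos.le t)]
  exact mul_le_mul_of_nonneg_left (abs_iterate_stepOp_le hπ hC t s) (pow_nonneg M.γ_pos.le t)

theorem abs_V_le_of_bound (hπ : IsPolicy π) {C : ℝ}
    (hC : ∀ s, |stageCost M h π s| ≤ C) (s : S) : |V M h π s| ≤ C / (1 - M.γ) := by
  rw [V, ← Real.norm_eq_abs]
  refine tsum_of_norm_bounded (g := fun t : ℕ => M.γ ^ t * C) ?_ fun t => ?_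
  · rw [div_eq_inv_mul]
    exact (hasSum_geometric_of_lt_one M.γ_pos.le M.γ_lt_one).mul_right C
  · rw [Real.norm_eq_abs, abs_mul, abs_of_nonneg (pow_nonneg M.γ_pos.le t)]
    exact mul_le_mul_of_nonneg_left (abs_iterate_stepOp_le hπ hC t s) (pow_nonneg M.γ_pos.le t)

theorem hasSum_V (hπ : IsPolicy π) (s : S) :
    HasSum (fun t : ℕ => M.γ ^ t * (stepOp M π)^[t] (stageCost M h π) s) (V M h π s) := by
  obtain ⟨C, hC⟩ := exists_bound (stageCost M h π)
  exact (summable_value_of_bound hπ hC s).hasSum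

/-- The Bellman equation of a policy. -/
theorem V_eq (hπ : IsPolicy π) (s : S) :
    V M h π s = stageCost M h π s + M.γ * stepOp M π (V M h π) s := by
  have h1 : HasSum (fun t : ℕ => M.γ * ∑ a, π s a * ∑ s', M.P s a s' *
      (M.γ ^ t * (stepOp M π)^[t] (stageCost M h π) s')) (M.γ * stepOp M π (V M h π) s) :=
    (hasSum_sum fun a _ => (hasSum_sum fun s' _ => (hasSum_V hπ s').mul_left _).mul_left _).mul_left _
  have h2 : HasSum (fun t : ℕ => M.γ ^ (t + 1) * (stepOp M π)^[t + 1] (stageCost M h π) s)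
      (M.γ * stepOp M π (V M h π) s) := by
    convert h1 using 2 with t
    rw [Function.iterate_succ_apply', stepOp, pow_succ', mul_assoc]
    simp only [Finset.mul_sum]
    refine Finset.sum_congr rfl fun a _ => Finset.sum_congr rfl fun s' _ => ?_
    ring
  have h3 := (hasSum_nat_add_iff' 1).2 (hasSum_V (M := M) (h := h) hπ s)
  have h4 := h2.unique h3
  rw [h4]
  simp

theorem Q_eq (hπ : IsPolicy π) (s : S) (a : A) :
    Q M h π s a = M.c s a + h s (π s) + M.γ * ∑ s', M.P s a s' * V M h π s' := by
  have h1 : HasSum (fun t : ℕ => M.γ * ∑ s', M.P s a s' *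
      (M.γ ^ t * (stepOp M π)^[t] (stageCost M h π) s')) (M.γ * ∑ s', M.P s a s' * V M h π s') :=
    (hasSum_sum fun s' _ => (hasSum_V hπ s').mul_left _).mul_left _
  rw [Q, ← h1.tsum_eq]
  congr 2
  funext t
  simp only [Finset.mul_sum]
  refine Finset.sum_congr rfl fun s' _ => ?_
  ring

/-- `Q` contains the regularizer at `π`. Exchanging it for the one at `π'` turns the average of `Q`
into one Bellman step of `π'` applied to the value of `π`. -/
theorem pair_Q_eq (hπ : IsPolicy π) (hπ' : IsPolicy π') (s : S) :
    pair (Q M h π s) (π' s) + h s (π' s) - h s (π s)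
      = stageCost M h π' s + M.γ * stepOp M π' (V M h π) s := by
  have h1 : pair (Q M h π s) (π' s) = ∑ a, π' s a * M.c s a + h s (π s)
      + M.γ * stepOp M π' (V M h π) s := by
    have h2 : h s (π s) = ∑ a, π' s a * h s (π s) := by
      rw [← Finset.sum_mul, (hπ' s).2, one_mul]
    rw [pair, h2, stepOp, Finset.mul_sum, ← Finset.sum_add_distrib, ← Finset.sum_add_distrib]
    refine Finset.sum_congr rfl fun a _ => ?_
    rw [Q_eq hπ]
    ring
  rw [h1, stageCost]
  ring

theorem pair_Q_self (hπ : IsPolicy π) (s : S) : pair (Q M h π s) (π s) = V M h π s := by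
  have := pair_Q_eq (M := M) (h := h) hπ hπ s
  rw [V_eq hπ s]
  linarith

/-- The change of the value function under a change of policy, bounded through the one-step
advantage. -/
theorem V_sub_le (hπ : IsPolicy π) (hπ' : IsPolicy π') {w : S → ℝ} {e : ℝ} (hw : ∀ s, w s ≤ 0)
    (hA : ∀ s, pair (Q M h π s) (π' s - π s) + h s (π' s) - h s (π s) ≤ w s + e) (s : S) :
    V M h π' s - V M h π s ≤ w s + e / (1 - M.γ) := by
  have hγ : 0 < 1 - M.γ := by linarith [M.γ_lt_one]
  have key : ∀ s, V M h π' s - V M h π s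
      ≤ w s + e + M.γ * stepOp M π' (fun s => V M h π' s - V M h π s) s := by
    intro s
    have h1 := hA s
    rw [pair_sub_right, pair_Q_self hπ] at h1
    have h2 := pair_Q_eq (M := M) (h := h) hπ hπ' s
    have h3 := V_eq (M := M) (h := h) hπ' s
    rw [stepOp_sub]
    linarith
  -- At a state of largest difference the recursion closes and bounds the maximum by `e/(1-γ)`.
  -- Reinserting this bound in `key` retains the negative term `w s`.
  obtain ⟨s₀, -, hs₀⟩ := Finset.exists_max_image Finset.univ
    (fun s => V M h π' s - V M h π s) ⟨s, Finset.mem_univ s⟩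
  have hmax : V M h π' s₀ - V M h π s₀ ≤ e / (1 - M.γ) := by
    have h1 := key s₀
    have h2 := mul_le_mul_of_nonneg_left
      (stepOp_le (M := M) hπ' (fun s => hs₀ s (Finset.mem_univ s)) s₀) M.γ_pos.le
    rw [le_div_iff₀ hγ]
    have h3 := hw s₀
    linarith
  have h1 := key s
  have h2 := mul_le_mul_of_nonneg_left
    (stepOp_le (M := M) hπ' (fun s => (hs₀ s (Finset.mem_univ s)).trans hmax) s) M.γ_pos.le
  have h3 : e + M.γ * (e / (1 - M.γ)) = e / (1 - M.γ) := by field_simp; ring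
  linarith

theorem IsStationary.sum_stepOp {ν : S → ℝ} (hν : IsStationary M π ν) (g : S → ℝ) :
    ∑ s, ν s * stepOp M π g s = ∑ s, ν s * g s := by
  have h1 : ∀ s, ν s * stepOp M π g s = ∑ s', (ν s * ∑ a, π s a * M.P s a s') * g s' := by
    intro s
    simp only [stepOp, Finset.mul_sum, Finset.sum_mul]
    rw [Finset.sum_comm]
    refine Finset.sum_congr rfl fun a _ => Finset.sum_congr rfl fun s' _ => ?_
    ring
  simp_rw [h1]
  rw [Finset.sum_comm]
  refine Finset.sum_congr rfl fun s' _ => ?_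
  rw [← Finset.sum_mul, hν.2]

/-- The performance difference with respect to a policy and its stationary distribution. -/
theorem sum_stationary_advantage {πs : S → A → ℝ} {ν : S → ℝ} (hπ : IsPolicy π)
    (hπs : IsPolicy πs) (hν : IsStationary M πs ν) :
    ∑ s, ν s * (pair (Q M h π s) (π s - πs s) + h s (π s) - h s (πs s))
      = (1 - M.γ) * (objective M h ν π - objective M h ν πs) := by
  have h1 : ∀ s, pair (Q M h π s) (π s - πs s) + h s (π s) - h s (πs s)
      = (V M h π s - V M h πs s) - M.γ * stepOp M πs (fun s => V M h π s - V M h πs s) s := by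
    intro s
    rw [pair_sub_right, pair_Q_self hπ, stepOp_sub]
    have h2 := pair_Q_eq (M := M) (h := h) hπ hπs s
    have h3 := V_eq (M := M) (h := h) hπs s
    linarith
  simp_rw [h1, mul_sub (ν _) (V M h π _ - V M h πs _), mul_left_comm (ν _) M.γ,
    Finset.sum_sub_distrib, ← Finset.mul_sum]
  rw [hν.sum_stepOp, objective, objective, ← Finset.sum_sub_distrib]
  simp_rw [← mul_sub]
  ring

end Value

/-! ### Constants of the subproblems -/

section Constants

variable {γ μ L : ℝ}

theorem subModulus_eq (hγ : 0 < γ) (hμ : 0 < μ) : subModulus γ μ = 1 / γ := by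
  rw [subModulus, stepsize]
  field_simp
  ring

theorem subModulus_pos (hγ : 0 < γ) (hμ : 0 < μ) : 0 < subModulus γ μ := by
  rw [subModulus_eq hγ hμ]; positivity

theorem four_mul_subModulus_le : 4 * subModulus γ μ ≤ subSmooth γ μ L :=
  mul_le_mul_of_nonneg_left (le_max_right _ _) (by norm_num)

theorem four_mul_stepsize_le : 4 * (stepsize γ μ * L) ≤ subSmooth γ μ L :=
  mul_le_mul_of_nonneg_left (le_max_left _ _) (by norm_num)

theorem stepsize_pos (hγ : 0 < γ) (hγ1 : γ < 1) (hμ : 0 < μ) : 0 < stepsize γ μ :=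
  div_pos (by linarith) (by positivity)

theorem decay_pos (k : ℕ) : 0 < decay γ k := by unfold decay; positivity

theorem decay_succ_le (k : ℕ) : decay γ (k + 1) ≤ decay γ k :=
  pow_le_pow_of_le_one (by norm_num) (by norm_num)
    (Nat.add_le_add_right (Nat.div_le_div_right (Nat.le_succ k)) 2)

end Constants

/-! ### One outer iteration for a fixed realization -/

section Path

variable {S A : Type*} [Fintype S] [Fintype A] {M : MDP S A} {h : S → (A → ℝ) → ℝ}
  {gradh : S → (A → ℝ) → (A → ℝ)} {μ L : ℝ} {R : S → Set (A → ℝ)} {T : ℕ → ℕ}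
  {Qhat : ℕ → S → A → ℝ} {π v : ℕ → S → A → ℝ} {x y : ℕ → ℕ → S → A → ℝ}

theorem IsInexactSPMD.isPolicy [Nonempty A] (hμ : 0 < μ)
    (hrun : IsInexactSPMD M gradh μ L T Qhat π v x y) (k : ℕ) :
    IsPolicy (π k) ∧ IsPolicy (v k) := by
  rcases k with _ | k
  · rw [hrun.π_zero, hrun.v_zero]
    exact ⟨fun s => (uniformPolicy_mem s).1, fun s => (uniformPolicy_mem s).1⟩
  · rw [hrun.π_succ, hrun.v_succ]
    have := fun s => (hrun.inner k s).step_mem (subModulus_pos M.γ_pos hμ) four_mul_subModulus_le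
      (uniformPolicy_mem s).1 (T k) le_rfl
    exact ⟨fun s => (this s).2, fun s => (this s).1⟩

theorem IsInexactSPMD.mem_posSimplex [Nonempty A]
    (hrun : IsInexactSPMD M gradh μ L T Qhat π v x y) (hRp : ∀ s, R s ⊆ posSimplex A)
    (hR : ∀ k s, ∀ t ≤ T k, x k t s ∈ R s ∧ y k t s ∈ R s) (k : ℕ) (s : S) :
    π k s ∈ posSimplex A ∧ v k s ∈ posSimplex A := by
  rcases k with _ | k
  · rw [hrun.π_zero, hrun.v_zero]
    exact ⟨uniformPolicy_mem s, uniformPolicy_mem s⟩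
  · rw [hrun.π_succ, hrun.v_succ]
    have := hR k s (T k) le_rfl
    exact ⟨hRp s this.2, hRp s this.1⟩

theorem IsInexactSPMD.sqrt_mul_le [Nonempty A] (hμ : 0 < μ) (hT : ∀ k, 1 ≤ T k)
    (hrun : IsInexactSPMD M gradh μ L T Qhat π v x y) (k : ℕ) (s : S) (a : A) :
    Real.sqrt (subModulus M.γ μ / subSmooth M.γ μ L) * v k s a ≤ π k s a := by
  have hm := subModulus_pos M.γ_pos hμ
  have hΛ := four_mul_subModulus_le (γ := M.γ) (μ := μ) (L := L)
  rcases k with _ | k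
  · rw [hrun.π_zero, hrun.v_zero]
    have h1 := (uniformPolicy_mem (A := A) s).2 a
    have h2 := (sqrt_div_facts hm hΛ).2.1
    nlinarith
  · rw [hrun.π_succ, hrun.v_succ]
    exact (hrun.inner k s).last_ge hm hΛ (uniformPolicy_mem s).1 (hT k) a

/-- The accuracy of the policy update. -/
theorem IsInexactSPMD.update_accuracy [Nonempty A] (hμ : 0 < μ) (hL : 0 ≤ L)
    (hh : IsStronglyConvexReg h gradh μ) (hS : IsSmoothOn gradh L R)
    (hT : AdmissibleSteps M.γ μ L T) (hrun : IsInexactSPMD M gradh μ L T Qhat π v x y)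
    (hR : ∀ k s, ∀ t ≤ T k, x k t s ∈ R s ∧ y k t s ∈ R s) (k : ℕ) (s : S)
    {p : A → ℝ} (hp : p ∈ stdSimplex ℝ A) :
    pair (Qhat k s) (π (k + 1) s) + h s (π (k + 1) s)
        + M.γ * μ / (1 - M.γ) * KL (π (k + 1) s) (v k s) + μ / (1 - M.γ) * KL p (v (k + 1) s)
      ≤ pair (Qhat k s) p + h s p + M.γ * μ / (1 - M.γ) * KL p (v k s)
        + M.γ * μ / (1 - M.γ)
          * ((1 - M.γ) ^ 2 * decay M.γ (k + 1) * Real.log (Fintype.card A)) := by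
  have hγ := M.γ_pos
  have hγ1 : 0 < 1 - M.γ := by linarith [M.γ_lt_one]
  have hη := stepsize_pos M.γ_pos M.γ_lt_one hμ
  set η := stepsize M.γ μ with hηd
  have hv := (hrun.mem_posSimplex hS.subset hR k s).2
  have key := (hrun.inner k s).accuracy (φ := fun p => η * (pair (Qhat k s) p + h s p))
    (Lφ := η * L) (R := R s) (by positivity) rfl four_mul_subModulus_le (by positivity)
    four_mul_stepsize_le hv (hS.subset s) (hS.convex s) (hR k s)
    (fun p hp p' hp' => by
      have h1 := mul_le_mul_of_nonneg_left (hh.strong s p hp p' hp') hη.le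
      simp only [pair_sub_right, pair_smul_left, pair_add_left] at h1 ⊢
      linarith)
    (fun p hp p' hp' a => by
      have h1 := mul_le_mul_of_nonneg_left (hS.lipschitz s p hp p' hp' a) hη.le
      have h2 : (η • (Qhat k s + gradh s p)) a - (η • (Qhat k s + gradh s p')) a
          = η * (gradh s p a - gradh s p' a) := by
        simp; ring
      rw [← hηd, h2, abs_mul, abs_of_pos hη]
      linarith)
    hp (hT k).1
  have hlog : KL p (uniformPolicy S A s) ≤ Real.log (Fintype.card A) := KL_uniformPolicy_le s hp
  have hlog0 : 0 ≤ KL p (uniformPolicy S A s) := KL_nonneg hp (uniformPolicy_mem s)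
  have hε : agdAccuracy (subSmooth M.γ μ L) (subModulus M.γ μ) (T k) * KL p (uniformPolicy S A s)
      ≤ (1 - M.γ) ^ 2 * decay M.γ (k + 1) * Real.log (Fintype.card A) :=
    mul_le_mul (hT k).2 hlog hlog0 (mul_nonneg (sq_nonneg _) (decay_pos _).le)
  have h1 := key.trans hε
  rw [hrun.π_succ, hrun.v_succ]
  have hβ : 0 ≤ M.γ * μ / (1 - M.γ) := by positivity
  -- The accuracy bound is divided by `η`; as the modulus is `1/γ`, the divergence from `v (k + 1)`
  -- acquires the coefficient `μ/(1-γ)`.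
  have hβη : M.γ * μ / (1 - M.γ) * η = 1 := by
    rw [hηd, stepsize]; field_simp
  have hβm : M.γ * μ / (1 - M.γ) * subModulus M.γ μ = μ / (1 - M.γ) := by
    rw [subModulus_eq hγ hμ]; field_simp
  have h2 := mul_le_mul_of_nonneg_left h1 hβ
  rw [← hηd, show 1 + η * μ = subModulus M.γ μ from rfl] at h2
  set β := M.γ * μ / (1 - M.γ)
  have e : ∀ X, β * (η * X) = X := fun X => by rw [← mul_assoc, hβη, one_mul]
  have e' : ∀ X, β * (subModulus M.γ μ * X) = μ / (1 - M.γ) * X := fun X => by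
    rw [← mul_assoc, hβm]
  rw [mul_add β (_ - _), mul_sub β, mul_add β, mul_add β (η * _), e, e, e'] at h2
  linarith

/-- The output of the inner method is close to its last prox-iterate. -/
theorem IsInexactSPMD.KL_last_le [Nonempty A] (hμ : 0 < μ) (hL : 0 ≤ L)
    (hh : IsStronglyConvexReg h gradh μ) (hS : IsSmoothOn gradh L R)
    (hT : AdmissibleSteps M.γ μ L T) (hrun : IsInexactSPMD M gradh μ L T Qhat π v x y)
    (hR : ∀ k s, ∀ t ≤ T k, x k t s ∈ R s ∧ y k t s ∈ R s) (k : ℕ) (s : S) :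
    KL (π k s) (v k s)
      ≤ M.γ * ((1 - M.γ) ^ 2 * decay M.γ k * Real.log (Fintype.card A)) := by
  have hγ1 : 0 < 1 - M.γ := by linarith [M.γ_lt_one]
  have hγ := M.γ_pos
  have hlog : 0 ≤ Real.log (Fintype.card A) := Real.log_natCast_nonneg _
  rcases k with _ | k
  · rw [hrun.π_zero, hrun.v_zero, KL_self (uniformPolicy_mem s)]
    have := (decay_pos (γ := M.γ) 0).le
    positivity
  · have h1 := hrun.update_accuracy hμ hL hh hS hT hR k s
      (hrun.mem_posSimplex hS.subset hR (k + 1) s).1.1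
    have h2 : μ / (1 - M.γ) * KL (π (k + 1) s) (v (k + 1) s) ≤ M.γ * μ / (1 - M.γ)
          * ((1 - M.γ) ^ 2 * decay M.γ (k + 1) * Real.log (Fintype.card A)) := by linarith
    have h3 : M.γ * μ / (1 - M.γ) = μ / (1 - M.γ) * M.γ := by ring
    rw [h3, mul_assoc] at h2
    exact le_of_mul_le_mul_left h2 (by positivity)

/-- Hölder, Young with free parameter `b`, then Pinsker. -/
theorem abs_pair_sub_le_add_KL {δ p q : A → ℝ} {C β b : ℝ} (hC : ∀ a, |δ a| ≤ C)
    (hβ : 0 < β) (hb : 0 < b) (hp : p ∈ stdSimplex ℝ A) (hq : q ∈ posSimplex A) :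
    |pair δ (p - q)| ≤ b * C ^ 2 / (2 * β) + β / b * KL p q := by
  have h1 := abs_pair_sub_le δ p q hC
  have h2 := sq_l1dist_le hp hq
  have h3 : C * l1dist p q ≤ b * C ^ 2 / (2 * β) + β / b * (l1dist p q ^ 2 / 2) := by
    have : b * C ^ 2 / (2 * β) + β / b * (l1dist p q ^ 2 / 2) - C * l1dist p q
        = (b * C - β * l1dist p q) ^ 2 / (2 * β * b) := by
      field_simp; ring
    have : 0 ≤ (b * C - β * l1dist p q) ^ 2 / (2 * β * b) := by positivity
    linarith
  have h4 : β / b * (l1dist p q ^ 2 / 2) ≤ β / b * KL p q := by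
    gcongr; linarith
  linarith

theorem abs_apply_le_norm (δ : S → A → ℝ) (s : S) (a : A) : |δ s a| ≤ ‖δ‖ :=
  (norm_le_pi_norm (δ s) a).trans (norm_le_pi_norm δ s)

/-- One iteration of the method, for a given realization. -/
theorem IsInexactSPMD.potential_succ_le [Nonempty A] (hμ : 0 < μ) (hL : 0 ≤ L)
    (hh : IsStronglyConvexReg h gradh μ) (hS : IsSmoothOn gradh L R)
    (hT : AdmissibleSteps M.γ μ L T) (hrun : IsInexactSPMD M gradh μ L T Qhat π v x y)
    (hR : ∀ k s, ∀ t ≤ T k, x k t s ∈ R s ∧ y k t s ∈ R s)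
    {πs : S → A → ℝ} {ν : S → ℝ} (hπs : IsPolicy πs) (hν : IsStationary M πs ν) (k : ℕ) :
    objective M h ν (π (k + 1)) - objective M h ν πs + μ / (1 - M.γ) * avgDist ν (v (k + 1)) πs
      ≤ M.γ * (objective M h ν (π k) - objective M h ν πs + μ / (1 - M.γ) * avgDist ν (v k) πs)
        + (M.γ * μ * (1 + 3 / 2 * M.γ + M.γ ^ 2) * decay M.γ k * Real.log (Fintype.card A)
          + 5 / (6 * M.γ * μ) * ‖Qhat k - Q M h (π k)‖ ^ 2
          - ∑ s, ν s * pair (Qhat k s - Q M h (π k) s) (π k s - πs s)) := by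
  have hγ := M.γ_pos
  have hγ1 : 0 < 1 - M.γ := by linarith [M.γ_lt_one]
  set N := ‖Qhat k - Q M h (π k)‖ with hN
  set E := (1 - M.γ) ^ 2 * decay M.γ k * Real.log (Fintype.card A) with hE
  have hlog : 0 ≤ Real.log (Fintype.card A) := Real.log_natCast_nonneg _
  have hE0 : 0 ≤ E := mul_nonneg (mul_nonneg (sq_nonneg _) (decay_pos _).le) hlog
  have hE1 : (1 - M.γ) ^ 2 * decay M.γ (k + 1) * Real.log (Fintype.card A) ≤ E :=
    mul_le_mul_of_nonneg_right (mul_le_mul_of_nonneg_left (decay_succ_le k) (sq_nonneg _)) hlog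
  set β := M.γ * μ / (1 - M.γ) with hβ
  have hβ0 : 0 < β := by positivity
  have hE2 := mul_le_mul_of_nonneg_left hE1 hβ0.le
  have hmem := hrun.mem_posSimplex hS.subset hR
  have hpol := hrun.isPolicy hμ
  set a : S → ℝ := fun s => pair (Qhat k s) (π (k + 1) s - π k s) + h s (π (k + 1) s)
    - h s (π k s) with ha
  set e1 := β * (1 + M.γ) * E with he1
  set e := e1 + 5 / (6 * β) * N ^ 2 + 3 / 2 * β * (M.γ * E) with he
  have hlast := fun s => hrun.KL_last_le hμ hL hh hS hT hR k s
  -- Comparison of the update with `p = π k`; the slack `e1` covers the inner error and `KL (π k s)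
  -- (v k s)`. The sign is what `V_sub_le` requires.
  have hw : ∀ s, a s + β * KL (π (k + 1) s) (v k s) - e1 ≤ 0 := by
    intro s
    have h1 :=
      hrun.update_accuracy hμ hL hh hS hT hR k s (hmem k s).1.1
    have h2 := mul_le_mul_of_nonneg_left (hlast s) hβ0.le
    have h3 : 0 ≤ μ / (1 - M.γ) * KL (π k s) (v (k + 1) s) :=
      mul_nonneg (by positivity) (KL_nonneg (hmem k s).1.1 (hmem (k + 1) s).2)
    simp only [ha, he1, pair_sub_right]
    linarith
  have hA : ∀ s, pair (Q M h (π k) s) (π (k + 1) s - π k s) + h s (π (k + 1) s) - h s (π k s)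
      ≤ a s + β * KL (π (k + 1) s) (v k s) - e1 + e := by
    intro s
    have hδ : ∀ b, |(Qhat k s - Q M h (π k) s) b| ≤ N :=
      abs_apply_le_norm (Qhat k - Q M h (π k)) s
    -- The error against `π (k + 1) - π k` is split at `v k`. With `b = 1` the first divergence is
    -- exactly the available prox term. With `b = 2/3` the total coefficient of `N²/β` is `1/2 + 1/3
    -- = 5/6`, for which the term `5/(8γμ)` of `rateConst` pays exactly.
    have h1 := abs_pair_sub_le_add_KL hδ hβ0 one_pos (hmem (k + 1) s).1.1 (hmem k s).2
    have h2 := abs_pair_sub_le_add_KL hδ hβ0 (b := 2 / 3) (by norm_num) (hmem k s).1.1 (hmem k s).2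
    have h3 := mul_le_mul_of_nonneg_left (hlast s) (by positivity : 0 ≤ β / (2 / 3))
    have h4 := neg_le_of_abs_le h1
    have h5 := le_of_abs_le h2
    have e5 : 1 * N ^ 2 / (2 * β) + 2 / 3 * N ^ 2 / (2 * β) = 5 / (6 * β) * N ^ 2 := by
      field_simp; ring
    have e6 : β / (2 / 3) * (M.γ * E) = 3 / 2 * β * (M.γ * E) := by ring
    simp only [ha, he, pair_sub_right, pair_sub_left, div_one] at *
    linarith
  have hV := V_sub_le (M := M) (h := h) (hpol k).1 (hpol (k + 1)).1 hw hA
  -- Adding the accuracy bound at `p = π*` cancels the unknown terms at `π (k + 1)`, including its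
  -- prox term.
  have hper : ∀ s, V M h (π (k + 1)) s - V M h (π k) s
      + (pair (Q M h (π k) s) (π k s - πs s) + h s (π k s) - h s (πs s))
      + pair (Qhat k s - Q M h (π k) s) (π k s - πs s)
      + μ / (1 - M.γ) * KL (πs s) (v (k + 1) s)
      ≤ β * KL (πs s) (v k s) + (β * E + e / (1 - M.γ) - e1) := by
    intro s
    have h1 := hV s
    have h2 := hrun.update_accuracy hμ hL hh hS hT hR k s (hπs s)
    simp only [ha, pair_sub_right, pair_sub_left] at *
    linarith
  have hsum : ∑ s, ν s * (V M h (π (k + 1)) s - V M h (π k) s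
      + (pair (Q M h (π k) s) (π k s - πs s) + h s (π k s) - h s (πs s))
      + pair (Qhat k s - Q M h (π k) s) (π k s - πs s)
      + μ / (1 - M.γ) * KL (πs s) (v (k + 1) s))
      ≤ ∑ s, ν s * (β * KL (πs s) (v k s) + (β * E + e / (1 - M.γ) - e1)) :=
    Finset.sum_le_sum fun s _ => mul_le_mul_of_nonneg_left (hper s) (hν.1.1 s)
  simp_rw [mul_add (ν _) _ (β * E + e / (1 - M.γ) - e1), Finset.sum_add_distrib,
    ← Finset.sum_mul, hν.1.2, one_mul, mul_left_comm (ν _) β, ← Finset.mul_sum] at hsum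
  have hl : ∑ s, ν s * (V M h (π (k + 1)) s - V M h (π k) s
      + (pair (Q M h (π k) s) (π k s - πs s) + h s (π k s) - h s (πs s))
      + pair (Qhat k s - Q M h (π k) s) (π k s - πs s)
      + μ / (1 - M.γ) * KL (πs s) (v (k + 1) s))
      = objective M h ν (π (k + 1)) - objective M h ν (π k)
        + ∑ s, ν s * (pair (Q M h (π k) s) (π k s - πs s) + h s (π k s) - h s (πs s))
        + ∑ s, ν s * pair (Qhat k s - Q M h (π k) s) (π k s - πs s)
        + μ / (1 - M.γ) * avgDist ν (v (k + 1)) πs := by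
    rw [objective, objective, avgDist, Finset.mul_sum, ← Finset.sum_sub_distrib,
      ← Finset.sum_add_distrib, ← Finset.sum_add_distrib, ← Finset.sum_add_distrib]
    exact Finset.sum_congr rfl fun s _ => by ring
  rw [hl, sum_stationary_advantage (hpol k).1 hπs hν] at hsum
  have hconst : β * E + e / (1 - M.γ) - e1
      = M.γ * μ * (1 + 3 / 2 * M.γ + M.γ ^ 2) * decay M.γ k * Real.log (Fintype.card A)
          + 5 / (6 * M.γ * μ) * N ^ 2 := by
    rw [he, he1, hE, hβ]
    field_simp
    ring
  rw [hconst] at hsum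
  have hβ' : β * ∑ s, ν s * KL (πs s) (v k s)
      = M.γ * (μ / (1 - M.γ) * avgDist ν (v k) πs) := by
    rw [hβ, avgDist]; ring
  linarith

/-- The divergence from the policy is controlled by the divergence from the prox-iterate. -/
theorem IsInexactSPMD.avgDist_le [Nonempty A] (hμ : 0 < μ) (hL : 0 ≤ L)
    (hh : IsStronglyConvexReg h gradh μ) (hS : IsSmoothOn gradh L R)
    (hT : AdmissibleSteps M.γ μ L T) (hrun : IsInexactSPMD M gradh μ L T Qhat π v x y)
    (hR : ∀ k s, ∀ t ≤ T k, x k t s ∈ R s ∧ y k t s ∈ R s)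
    {πs : S → A → ℝ} {ν : S → ℝ} (hπs : IsPolicy πs) (hν : ν ∈ stdSimplex ℝ S) (k : ℕ) {lam : ℝ}
    (hlam : lam = 2 - Real.log (Real.sqrt (subModulus M.γ μ / subSmooth M.γ μ L))) :
    avgDist ν (π k) πs ≤ lam * avgDist ν (v k) πs
      + 2 * lam * (M.γ * ((1 - M.γ) ^ 2 * decay M.γ k * Real.log (Fintype.card A))) := by
  have hmem := hrun.mem_posSimplex hS.subset hR
  obtain ⟨hα, hα2, -⟩ := sqrt_div_facts (subModulus_pos M.γ_pos hμ)
    (four_mul_subModulus_le (γ := M.γ) (μ := μ) (L := L))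
  have hlam0 : 0 ≤ lam := by
    have := Real.log_nonpos hα.le (by linarith)
    linarith
  set E := M.γ * ((1 - M.γ) ^ 2 * decay M.γ k * Real.log (Fintype.card A)) with hE
  have h1 : ∀ s, KL (πs s) (π k s) ≤ lam * KL (πs s) (v k s) + 2 * lam * E := by
    intro s
    have h2 := KL_le_of_mul_le (hπs s) (hmem k s).2 (hmem k s).1 hα (by linarith)
      (hrun.sqrt_mul_le hμ (fun k => (hT k).1) k s)
    rw [← hlam] at h2
    have h3 := mul_le_mul_of_nonneg_left (hrun.KL_last_le hμ hL hh hS hT hR k s)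
      (by positivity : 0 ≤ 2 * lam)
    linarith
  have h2 : 2 * lam * E = ∑ s, ν s * (2 * lam * E) := by rw [← Finset.sum_mul, hν.2, one_mul]
  rw [avgDist, avgDist, Finset.mul_sum, h2, ← Finset.sum_add_distrib]
  refine Finset.sum_le_sum fun s _ => ?_
  have := mul_le_mul_of_nonneg_left (h1 s) (hν.1 s)
  linarith

end Path

/-! ### Boundedness and measurability of the value functions -/

section Measurability

variable {S A Ω : Type*} [Fintype S] [Fintype A] [MeasurableSpace Ω] {M : MDP S A}
  {h : S → (A → ℝ) → ℝ} {π : Ω → S → A → ℝ}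

theorem exists_bound_on_simplex {g : S → (A → ℝ) → ℝ}
    (hg : ∀ s, ContinuousOn (g s) (stdSimplex ℝ A)) :
    ∃ C, ∀ s, ∀ p ∈ stdSimplex ℝ A, |g s p| ≤ C := by
  choose C hC using fun s => (isCompact_stdSimplex ℝ A).exists_bound_of_continuousOn (hg s)
  obtain ⟨D, hD⟩ := exists_bound C
  exact ⟨D, fun s p hp => (hC s p hp).trans ((le_abs_self _).trans (hD s))⟩

theorem exists_bound_V (hh : ∀ s, ContinuousOn (h s) (stdSimplex ℝ A)) :
    ∃ C, ∀ π : S → A → ℝ, IsPolicy π → ∀ s, |V M h π s| ≤ C := by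
  obtain ⟨C, hC⟩ := exists_bound_on_simplex (g := fun s p => ∑ a, p a * M.c s a + h s p)
    fun s => (by fun_prop : Continuous fun p : A → ℝ => ∑ a, p a * M.c s a).continuousOn.add (hh s)
  exact ⟨C / (1 - M.γ), fun π hπ s => abs_V_le_of_bound hπ (fun s => hC s _ (hπ s)) s⟩

theorem exists_bound_Q (hh : ∀ s, ContinuousOn (h s) (stdSimplex ℝ A)) :
    ∃ C, ∀ π : S → A → ℝ, IsPolicy π → ∀ s a, |Q M h π s a| ≤ C := by
  obtain ⟨CV, hCV⟩ := exists_bound_V (M := M) hh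
  obtain ⟨Ch, hCh⟩ := exists_bound_on_simplex hh
  obtain ⟨Cc, hCc⟩ := exists_bound fun sa : S × A => M.c sa.1 sa.2
  refine ⟨Cc + Ch + M.γ * CV, fun π hπ s a => ?_⟩
  rw [Q_eq hπ]
  refine (abs_add_three _ _ _).trans (add_le_add_three (hCc (s, a)) (hCh s _ (hπ s)) ?_)
  rw [abs_mul, abs_of_pos M.γ_pos]
  refine mul_le_mul_of_nonneg_left ?_ M.γ_pos.le
  calc |∑ s', M.P s a s' * V M h π s'| ≤ ∑ s', |M.P s a s' * V M h π s'| :=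
        Finset.abs_sum_le_sum_abs _ _
    _ ≤ ∑ s', M.P s a s' * CV := Finset.sum_le_sum fun s' _ => by
        rw [abs_mul, abs_of_nonneg ((M.P_mem s a).1 s')]
        exact mul_le_mul_of_nonneg_left (hCV π hπ s') ((M.P_mem s a).1 s')
    _ = CV := by rw [← Finset.sum_mul, (M.P_mem s a).2, one_mul]

/-- Continuity is known only on the simplex, so the composition is factored through the subtype. -/
theorem measurable_comp_simplex {g : (A → ℝ) → ℝ} (hg : ContinuousOn g (stdSimplex ℝ A))
    {p : Ω → A → ℝ} (hp : ∀ ω, p ω ∈ stdSimplex ℝ A) (hm : ∀ a, Measurable fun ω => p ω a) :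
    Measurable fun ω => g (p ω) := by
  have h1 : Measurable fun ω => (⟨p ω, hp ω⟩ : stdSimplex ℝ A) :=
    (measurable_pi_lambda _ hm).subtype_mk
  exact (continuousOn_iff_continuous_domRestrict.1 hg).measurable.comp h1

theorem measurable_stepOp (hm : ∀ s a, Measurable fun ω => π ω s a) {g : Ω → S → ℝ}
    (hg : ∀ s, Measurable fun ω => g ω s) (s : S) :
    Measurable fun ω => stepOp M (π ω) (g ω) s :=
  Finset.measurable_fun_sum _ fun a _ => (hm s a).mul
    (Finset.measurable_fun_sum _ fun s' _ => (hg s').const_mul _)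

theorem measurable_iterate_stepOp (hh : ∀ s, ContinuousOn (h s) (stdSimplex ℝ A))
    (hπ : ∀ ω, IsPolicy (π ω)) (hm : ∀ s a, Measurable fun ω => π ω s a) (t : ℕ) (s : S) :
    Measurable fun ω => (stepOp M (π ω))^[t] (stageCost M h (π ω)) s := by
  induction t generalizing s with
  | zero =>
    exact (Finset.measurable_fun_sum _ fun a _ => (hm s a).mul_const _).add
      (measurable_comp_simplex (hh s) (fun ω => hπ ω s) (hm s))
  | succ t ih =>
    simp only [Function.iterate_succ_apply']
    exact measurable_stepOp hm ih s

theorem measurable_V (hh : ∀ s, ContinuousOn (h s) (stdSimplex ℝ A))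
    (hπ : ∀ ω, IsPolicy (π ω)) (hm : ∀ s a, Measurable fun ω => π ω s a) (s : S) :
    Measurable fun ω => V M h (π ω) s :=
  Measurable.tsum fun t => (measurable_iterate_stepOp hh hπ hm t s).const_mul _

theorem measurable_Q (hh : ∀ s, ContinuousOn (h s) (stdSimplex ℝ A))
    (hπ : ∀ ω, IsPolicy (π ω)) (hm : ∀ s a, Measurable fun ω => π ω s a) (s : S) (a : A) :
    Measurable fun ω => Q M h (π ω) s a :=
  (measurable_const.add (measurable_comp_simplex (hh s) (fun ω => hπ ω s) (hm s))).add
    (Measurable.tsum fun t => (Finset.measurable_fun_sum _ fun s' _ =>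
      (measurable_iterate_stepOp hh hπ hm t s').const_mul _).const_mul _)

theorem measurable_KL (p : A → ℝ) {q : Ω → A → ℝ} (hm : ∀ a, Measurable fun ω => q ω a) :
    Measurable fun ω => KL p (q ω) :=
  Finset.measurable_fun_sum _ fun a _ =>
    (Real.measurable_log.comp ((hm a).const_div (p a))).const_mul _

end Measurability

/-! ### Integrability and the effect of the bias -/

section Stochastic

variable {S A Ω : Type*} [Fintype S] [Fintype A] [m : MeasurableSpace Ω]

/-- The standing assumptions on a run of the stochastic method. -/
structure IsStochasticRun (ℙ : Measure Ω) (ℱ : Filtration ℕ m) (M : MDP S A)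
    (h : S → (A → ℝ) → ℝ) (gradh : S → (A → ℝ) → (A → ℝ)) (μ L : ℝ) (R : S → Set (A → ℝ))
    (T : ℕ → ℕ) (Qhat : ℕ → Ω → S → A → ℝ) (π v : ℕ → Ω → S → A → ℝ)
    (x y : ℕ → ℕ → Ω → S → A → ℝ) : Prop where
  μ_pos : 0 < μ
  L_nonneg : 0 ≤ L
  reg : IsStronglyConvexReg h gradh μ
  smooth : IsSmoothOn gradh L R
  steps : AdmissibleSteps M.γ μ L T
  run : ∀ ω, IsInexactSPMD M gradh μ L T (fun k => Qhat k ω) (fun k => π k ω) (fun k => v k ω)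
    (fun k t => x k t ω) (fun k t => y k t ω)
  mem : ∀ᵐ ω ∂ℙ, ∀ k s, ∀ t ≤ T k, x k t ω s ∈ R s ∧ y k t ω s ∈ R s
  adapted : ∀ k s a, StronglyMeasurable[ℱ k] (fun ω => π k ω s a) ∧
    StronglyMeasurable[ℱ k] (fun ω => v k ω s a)
  est : IsEstimator ℙ ℱ M h (fun k => (1 - M.γ) * decay M.γ k) (fun k => decay M.γ k) Qhat π

variable {ℙ : Measure Ω} {ℱ : Filtration ℕ m} {M : MDP S A}
  {h : S → (A → ℝ) → ℝ} {gradh : S → (A → ℝ) → (A → ℝ)} {μ L : ℝ} {R : S → Set (A → ℝ)}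
  {T : ℕ → ℕ} {Qhat : ℕ → Ω → S → A → ℝ} {π v : ℕ → Ω → S → A → ℝ} {x y : ℕ → ℕ → Ω → S → A → ℝ}
  {πs : S → A → ℝ} {ν : S → ℝ}

namespace IsStochasticRun

theorem measurable_π (H : IsStochasticRun ℙ ℱ M h gradh μ L R T Qhat π v x y) (k : ℕ) (s : S)
    (a : A) : Measurable fun ω => π k ω s a :=
  ((H.adapted k s a).1.mono (ℱ.le k)).measurable

theorem measurable_v (H : IsStochasticRun ℙ ℱ M h gradh μ L R T Qhat π v x y) (k : ℕ) (s : S)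
    (a : A) : Measurable fun ω => v k ω s a :=
  ((H.adapted k s a).2.mono (ℱ.le k)).measurable

theorem stronglyMeasurable_sub (H : IsStochasticRun ℙ ℱ M h gradh μ L R T Qhat π v x y)
    (πs : S → A → ℝ) (k : ℕ) (s : S) (a : A) :
    StronglyMeasurable[ℱ k] fun ω => π k ω s a - πs s a :=
  (H.adapted k s a).1.sub stronglyMeasurable_const

variable [Nonempty A]

theorem isPolicy (H : IsStochasticRun ℙ ℱ M h gradh μ L R T Qhat π v x y) (k : ℕ) (ω : Ω) :
    IsPolicy (π k ω) :=
  ((H.run ω).isPolicy H.μ_pos k).1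

variable [IsProbabilityMeasure ℙ]

omit [Nonempty A] in
theorem integral_norm_sq_le (H : IsStochasticRun ℙ ℱ M h gradh μ L R T Qhat π v x y) (k : ℕ) :
    ∫ ω, ‖Qhat k ω - Q M h (π k ω)‖ ^ 2 ∂ℙ ≤ decay M.γ k := by
  rw [← integral_condExp (ℱ.le k)]
  refine (integral_mono_ae integrable_condExp (integrable_const _) (H.est.error k)).trans_eq ?_
  simp

theorem integrable_objective (H : IsStochasticRun ℙ ℱ M h gradh μ L R T Qhat π v x y) (k : ℕ) :
    Integrable (fun ω => objective M h ν (π k ω)) ℙ := by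
  obtain ⟨C, hC⟩ := exists_bound_V (M := M) H.reg.continuousOn
  refine integrable_finsetSum _ fun s _ => Integrable.const_mul (Integrable.of_bound
    (measurable_V H.reg.continuousOn (H.isPolicy k) (H.measurable_π k) s).aestronglyMeasurable C
    (ae_of_all _ fun ω => hC _ (H.isPolicy k ω) s)) _

theorem integrable_Q (H : IsStochasticRun ℙ ℱ M h gradh μ L R T Qhat π v x y) (k : ℕ) (s : S)
    (a : A) : Integrable (fun ω => Q M h (π k ω) s a) ℙ := by
  obtain ⟨C, hC⟩ := exists_bound_Q (M := M) H.reg.continuousOn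
  exact Integrable.of_bound
    (measurable_Q H.reg.continuousOn (H.isPolicy k) (H.measurable_π k) s a).aestronglyMeasurable C
    (ae_of_all _ fun ω => hC _ (H.isPolicy k ω) s a)

theorem integrable_Qhat (H : IsStochasticRun ℙ ℱ M h gradh μ L R T Qhat π v x y) (k : ℕ) (s : S)
    (a : A) : Integrable (fun ω => Qhat k ω s a) ℙ := by
  refine (((H.integrable_Q k s a).abs.add (integrable_const (1 : ℝ))).add
    (H.est.integrable k)).mono' ((H.est.measurable k s a).mono (ℱ.le _)).aestronglyMeasurable
    (ae_of_all _ fun ω => ?_)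
  have h1 := abs_apply_le_norm (Qhat k ω - Q M h (π k ω)) s a
  have h2 : |Qhat k ω s a| ≤ |Q M h (π k ω) s a| + |(Qhat k ω - Q M h (π k ω)) s a| := by
    refine le_trans (le_of_eq ?_) (abs_add_le _ _)
    simp
  -- Square integrability of the error dominates its first power.
  have h3 : ‖Qhat k ω - Q M h (π k ω)‖ ≤ 1 + ‖Qhat k ω - Q M h (π k ω)‖ ^ 2 := by
    nlinarith [sq_nonneg (‖Qhat k ω - Q M h (π k ω)‖ - 1)]
  simp only [Real.norm_eq_abs, Pi.add_apply]
  linarith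

/-- The divergence is unbounded as `v k` approaches the boundary of the simplex. The update
inequality dominates it by its predecessor plus integrable terms, whence the induction on `k`. -/
theorem integrable_KL (H : IsStochasticRun ℙ ℱ M h gradh μ L R T Qhat π v x y) (k : ℕ) (s : S)
    {p : A → ℝ} (hp : p ∈ stdSimplex ℝ A) : Integrable (fun ω => KL p (v k ω s)) ℙ := by
  have hγ1 : 0 < 1 - M.γ := by linarith [M.γ_lt_one]
  have hc : 0 < μ / (1 - M.γ) := div_pos H.μ_pos hγ1
  have hβ : 0 ≤ M.γ * μ / (1 - M.γ) := div_nonneg (mul_nonneg M.γ_pos.le H.μ_pos.le) hγ1.le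
  induction k with
  | zero =>
    have : (fun ω => KL p (v 0 ω s)) = fun _ => KL p (uniformPolicy S A s) := by
      funext ω; rw [(H.run ω).v_zero]
    rw [this]
    exact integrable_const _
  | succ k ih =>
    obtain ⟨C, hC⟩ := exists_bound_on_simplex H.reg.continuousOn
    have hQ : Integrable (fun ω => ∑ a, |Qhat k ω s a|) ℙ :=
      integrable_finsetSum _ fun a _ => (H.integrable_Qhat k s a).abs
    have hI := (((hQ.mul_const 2).add (integrable_const (2 * C))).add
      (ih.const_mul (M.γ * μ / (1 - M.γ)))).add (integrable_const (M.γ * μ / (1 - M.γ)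
          * ((1 - M.γ) ^ 2 * decay M.γ (k + 1) * Real.log (Fintype.card A))))
    rw [← integrable_const_mul_iff (IsUnit.mk0 _ hc.ne')]
    refine hI.mono' ((measurable_KL p (H.measurable_v (k + 1) s)).const_mul _).aestronglyMeasurable
      ?_
    filter_upwards [H.mem] with ω hω
    have hmem := (H.run ω).mem_posSimplex H.smooth.subset hω
    have h0 := KL_nonneg hp (hmem (k + 1) s).2
    have h1 := (H.run ω).update_accuracy H.μ_pos H.L_nonneg H.reg H.smooth H.steps hω k s hp
    have h2 := mul_nonneg hβ (KL_nonneg (hmem (k + 1) s).1.1 (hmem k s).2)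
    have h3 := abs_pair_sub_le (Qhat k ω s) p (π (k + 1) ω s) (C := ∑ a, |Qhat k ω s a|)
      fun a => Finset.single_le_sum (f := fun a => |Qhat k ω s a|) (fun _ _ => abs_nonneg _)
        (Finset.mem_univ a)
    have h4 : (∑ a, |Qhat k ω s a|) * l1dist p (π (k + 1) ω s) ≤ (∑ a, |Qhat k ω s a|) * 2 :=
      mul_le_mul_of_nonneg_left (l1dist_le_two hp (hmem (k + 1) s).1.1)
        (Finset.sum_nonneg fun _ _ => abs_nonneg _)
    have h5 := le_of_abs_le h3
    have h6 := le_of_abs_le (hC s p hp)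
    have h7 := neg_le_of_abs_le (hC s _ (hmem (k + 1) s).1.1)
    rw [pair_sub_right] at h5
    rw [Real.norm_eq_abs, abs_of_nonneg (mul_nonneg hc.le h0)]
    simp only [Pi.add_apply] at h1 h2 h7 ⊢
    linarith

theorem integrable_avgDist (H : IsStochasticRun ℙ ℱ M h gradh μ L R T Qhat π v x y) (k : ℕ)
    (hπs : IsPolicy πs) : Integrable (fun ω => avgDist ν (v k ω) πs) ℙ :=
  integrable_finsetSum _ fun s _ => (H.integrable_KL k s (hπs s)).const_mul _

omit [IsProbabilityMeasure ℙ] in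
theorem abs_sub_le_one (H : IsStochasticRun ℙ ℱ M h gradh μ L R T Qhat π v x y)
    (hπs : IsPolicy πs) (k : ℕ) (s : S) (a : A) (ω : Ω) : |π k ω s a - πs s a| ≤ 1 := by
  have h1 := mem_Icc_of_mem_stdSimplex (H.isPolicy k ω s) a
  have h2 := mem_Icc_of_mem_stdSimplex (hπs s) a
  rw [abs_le]
  constructor <;> linarith [h1.1, h1.2, h2.1, h2.2]

theorem integrable_error_mul (H : IsStochasticRun ℙ ℱ M h gradh μ L R T Qhat π v x y)
    (hπs : IsPolicy πs) (k : ℕ) (s : S) (a : A) :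
    Integrable (fun ω => (Qhat k ω s a - Q M h (π k ω) s a) * (π k ω s a - πs s a)) ℙ :=
  ((H.integrable_Qhat k s a).sub (H.integrable_Q k s a)).mul_bdd
    ((H.stronglyMeasurable_sub πs k s a).mono (ℱ.le k)).aestronglyMeasurable
    (ae_of_all _ (H.abs_sub_le_one hπs k s a))

/-- The contribution of the bias. -/
theorem neg_le_integral_pair (H : IsStochasticRun ℙ ℱ M h gradh μ L R T Qhat π v x y)
    (hπs : IsPolicy πs) (k : ℕ) (s : S) :
    -(2 * ((1 - M.γ) * decay M.γ k))
      ≤ ∫ ω, pair (Qhat k ω s - Q M h (π k ω) s) (π k ω s - πs s) ∂ℙ := by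
  set ς := (1 - M.γ) * decay M.γ k with hς
  have hς0 : 0 ≤ ς := mul_nonneg (by linarith [M.γ_lt_one]) (decay_pos k).le
  set w : A → Ω → ℝ := fun a ω => π k ω s a - πs s a with hw
  have hwm := fun a => H.stronglyMeasurable_sub πs k s a
  have hwb := fun a => H.abs_sub_le_one hπs k s a
  have hwa : ∀ a, AEStronglyMeasurable (w a) ℙ := fun a =>
    ((hwm a).mono (ℱ.le k)).aestronglyMeasurable
  have hI1 : ∀ a, Integrable (fun ω => Qhat k ω s a * w a ω) ℙ := fun a =>
    (H.integrable_Qhat k s a).mul_bdd (hwa a) (ae_of_all _ (hwb a))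
  have hI2 : ∀ a, Integrable (fun ω => Q M h (π k ω) s a * w a ω) ℙ := fun a =>
    (H.integrable_Q k s a).mul_bdd (hwa a) (ae_of_all _ (hwb a))
  set E : A → Ω → ℝ := fun a => ℙ[fun ω => Qhat k ω s a | ℱ k] with hE
  have hI3 : ∀ a, Integrable (fun ω => E a ω * w a ω) ℙ := fun a =>
    integrable_condExp.mul_bdd (hwa a) (ae_of_all _ (hwb a))
  have hI4 : ∀ a, Integrable (fun ω => (E a ω - Q M h (π k ω) s a) * w a ω) ℙ := fun a =>
    (integrable_condExp.sub (H.integrable_Q k s a)).mul_bdd (hwa a) (ae_of_all _ (hwb a))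
  have h1 : ∀ a, ∫ ω, Qhat k ω s a * w a ω ∂ℙ = ∫ ω, E a ω * w a ω ∂ℙ := by
    intro a
    -- `π k - π*` is measurable with respect to `ℱ k`, so the estimator may be replaced by its
    -- conditional expectation, leaving only the bias.
    have h2 := condExp_mul_of_stronglyMeasurable_right (hwm a) (hI1 a) (H.integrable_Qhat k s a)
    exact (integral_condExp (ℱ.le k)).symm.trans (integral_congr_ae h2)
  have h2 : ∫ ω, pair (Qhat k ω s - Q M h (π k ω) s) (π k ω s - πs s) ∂ℙ
      = ∫ ω, ∑ a, (E a ω - Q M h (π k ω) s a) * w a ω ∂ℙ := by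
    simp only [pair, Pi.sub_apply]
    rw [integral_finsetSum _ fun a _ => H.integrable_error_mul hπs k s a,
      integral_finsetSum _ fun a _ => hI4 a]
    refine Finset.sum_congr rfl fun a _ => ?_
    simp only [sub_mul]
    have e1 := integral_sub (hI1 a) (hI2 a)
    have e2 := integral_sub (hI3 a) (hI2 a)
    rw [e2, ← h1]
    exact e1
  rw [h2]
  have h3 : ∫ _, -(2 * ς) ∂ℙ = -(2 * ς) := by simp
  rw [← h3]
  refine integral_mono_ae (integrable_const _) (integrable_finsetSum _ fun a _ => hI4 a) ?_
  filter_upwards [ae_all_iff.2 fun a => H.est.bias k s a] with ω hω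
  have h4 := abs_pair_sub_le (fun a => E a ω - Q M h (π k ω) s a) (π k ω s) (πs s) hω
  have h5 := mul_le_mul_of_nonneg_left (l1dist_le_two (H.isPolicy k ω s) (hπs s)) hς0
  have h6 := neg_le_of_abs_le h4
  simp only [pair, Pi.sub_apply] at h6
  linarith

end IsStochasticRun
end Stochastic

/-! ### Epoch-wise recursion and the constants of the rate -/

section Recursion

variable {γ μ L : ℝ}

theorem epochLen_pos (hγ : 0 < γ) (hγ1 : γ < 1) : 0 < epochLen γ :=
  Nat.ceil_pos.2 (Real.logb_pos_of_base_lt_one hγ hγ1 (by norm_num) (by norm_num))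

theorem pow_epochLen_le (hγ : 0 < γ) (hγ1 : γ < 1) : γ ^ epochLen γ ≤ 1 / 4 := by
  rw [← Real.rpow_natCast]
  refine (Real.rpow_le_rpow_of_exponent_ge hγ hγ1.le (Nat.le_ceil _)).trans_eq ?_
  exact Real.rpow_logb hγ hγ1.ne (by norm_num)

/-- The epoch-wise solution of the recursion `X (k + 1) ≤ γ X k + c 2^{-(⌊k/l⌋ + 2)}`. -/
theorem le_half_pow_of_recursion {X : ℕ → ℝ} {B c : ℝ} (hγ : 0 < γ) (hγ1 : γ < 1) (hB : 0 ≤ B)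
    (h0 : X 0 ≤ B) (hc : 3 * c ≤ 4 * ((1 - γ) * B))
    (hstep : ∀ k, X (k + 1) ≤ γ * X k + c * decay γ k) (k : ℕ) :
    X k ≤ (1 / 2) ^ (k / epochLen γ) * B := by
  have hl := epochLen_pos hγ hγ1
  set l := epochLen γ with hld
  -- Inside epoch `i` the perturbation is constant, and `hc` places the fixed point of the affine
  -- recursion at or below `2^{-i} B/3`.
  have inner : ∀ i, X (l * i) ≤ (1 / 2) ^ i * B → ∀ j ≤ l,
      X (l * i + j) ≤ (1 / 2) ^ i * (γ ^ j * B + (1 - γ ^ j) * B / 3) := by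
    intro i hi j
    induction j with
    | zero => intro _; simpa using hi
    | succ j ih =>
      intro hj
      have h1 := ih (by omega)
      have h2 := hstep (l * i + j)
      have h3 : decay γ (l * i + j) = (1 / 2) ^ i / 4 := by
        rw [decay, ← hld, Nat.mul_add_div hl, Nat.div_eq_of_lt (by omega), add_zero, pow_add]
        ring
      rw [h3] at h2
      have h4 := mul_le_mul_of_nonneg_left h1 hγ.le
      have h5 := mul_le_mul_of_nonneg_left hc (by positivity : (0 : ℝ) ≤ (1 / 2) ^ i / 12)
      rw [← add_assoc]
      refine h2.trans ((add_le_add_left h4 _).trans ?_)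
      have e : (1 / 2 : ℝ) ^ i * (γ ^ (j + 1) * B + (1 - γ ^ (j + 1)) * B / 3)
          = γ * ((1 / 2) ^ i * (γ ^ j * B + (1 - γ ^ j) * B / 3))
            + (1 / 2) ^ i / 12 * (4 * ((1 - γ) * B)) := by
        rw [pow_succ]; ring
      rw [e]
      linarith
  have outer : ∀ i, X (l * i) ≤ (1 / 2) ^ i * B := by
    intro i
    induction i with
    | zero => simpa using h0
    | succ i ih =>
      have h1 := inner i ih l le_rfl
      -- At the end of the epoch `γ^l ≤ 1/4` gives `1/4 + (3/4)/3 = 1/2`.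
      have h2 := mul_le_mul_of_nonneg_right (pow_epochLen_le hγ hγ1) hB
      rw [← hld] at h2
      rw [mul_add_one]
      refine h1.trans ?_
      rw [pow_succ, mul_assoc]
      refine mul_le_mul_of_nonneg_left ?_ (by positivity)
      linarith
  have h1 := inner (k / l) (outer _) (k % l) (Nat.mod_lt _ hl).le
  rw [Nat.div_add_mod] at h1
  refine h1.trans (mul_le_mul_of_nonneg_left ?_ (by positivity))
  have h2 := pow_le_one₀ (n := k % l) hγ.le hγ1.le
  have h3 := mul_le_mul_of_nonneg_right h2 hB
  linarith

theorem subSmooth_eq (hγ : 0 < γ) (hμ : 0 < μ) :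
    subSmooth γ μ L = 4 * condNumber γ μ L * subModulus γ μ := by
  have hm := subModulus_pos hγ hμ
  rw [subSmooth, condNumber, mul_assoc 4, max_mul_of_nonneg _ _ hm.le, one_mul, max_comm]
  congr 2
  rw [subModulus_eq hγ hμ, stepsize]
  field_simp

theorem one_le_condNumber : 1 ≤ condNumber γ μ L := le_max_left _ _

theorem sqrt_subModulus_div (hγ : 0 < γ) (hμ : 0 < μ) :
    Real.sqrt (subModulus γ μ / subSmooth γ μ L) = 1 / (2 * Real.sqrt (condNumber γ μ L)) := by
  have hm := subModulus_pos hγ hμ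
  have hκ : 0 < condNumber γ μ L := one_pos.trans_le one_le_condNumber
  have e : subModulus γ μ / (4 * condNumber γ μ L * subModulus γ μ)
      = 1 / (2 ^ 2 * condNumber γ μ L) := by field_simp; norm_num
  rw [subSmooth_eq hγ hμ, e, Real.sqrt_div zero_le_one, Real.sqrt_one,
    Real.sqrt_mul (by norm_num), Real.sqrt_sq (by norm_num)]

theorem neg_log_sqrt_subModulus_div (hγ : 0 < γ) (hμ : 0 < μ) :
    -Real.log (Real.sqrt (subModulus γ μ / subSmooth γ μ L))
      = Real.log 2 + Real.log (condNumber γ μ L) / 2 := by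
  have hκ : 0 < condNumber γ μ L := one_pos.trans_le one_le_condNumber
  rw [sqrt_subModulus_div hγ hμ, one_div, Real.log_inv, neg_neg,
    Real.log_mul (by norm_num) (Real.sqrt_pos.2 hκ).ne', Real.log_sqrt hκ.le]

/-- `rateConst` must dominate both the initial potential and, after multiplication by `4(1-γ)/3`,
the coefficient of the perturbation; these are the hypotheses of `le_half_pow_of_recursion`. -/
theorem rateConst_facts {gap : ℝ} {n : ℕ} (hγ : 0 < γ) (hγ1 : γ < 1) (hμ : 0 < μ)
    (hgap : 0 ≤ gap) :
    0 < rateConst γ μ gap n ∧ gap + μ / (1 - γ) * Real.log n ≤ rateConst γ μ gap n ∧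
      3 * (γ * μ * (1 + 3 / 2 * γ + γ ^ 2) * Real.log n + 5 / (6 * γ * μ) + 2 * (1 - γ))
        ≤ 4 * ((1 - γ) * rateConst γ μ gap n) := by
  have hlog : 0 ≤ Real.log n := Real.log_natCast_nonneg _
  have h1 : 0 < 1 - γ := by linarith
  have hpos : 0 < 5 * (2 - γ) / 2 := by linarith
  have e : rateConst γ μ gap n = gap + μ / (1 - γ) * Real.log n
      + (5 * (2 - γ) / 2 + 5 / (8 * γ * μ) + 5 * μ * γ ^ 2 * (1 + γ) * Real.log n / 4)
        / (1 - γ) := by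
    rw [rateConst]; field_simp; ring
  have hX : 0 < (5 * (2 - γ) / 2 + 5 / (8 * γ * μ) + 5 * μ * γ ^ 2 * (1 + γ) * Real.log n / 4)
        / (1 - γ) := by
    have : 0 ≤ 5 / (8 * γ * μ) + 5 * μ * γ ^ 2 * (1 + γ) * Real.log n / 4 := by positivity
    exact div_pos (by linarith) h1
  have hY : 0 ≤ μ / (1 - γ) * Real.log n := by positivity
  refine ⟨by linarith, by linarith, ?_⟩
  have e2 : (1 - γ) * rateConst γ μ gap n = (1 - γ) * gap + μ * Real.log n
      + (5 * (2 - γ) / 2 + 5 / (8 * γ * μ) + 5 * μ * γ ^ 2 * (1 + γ) * Real.log n / 4) := by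
    rw [rateConst]; field_simp; ring
  rw [e2]
  have hg := mul_nonneg h1.le hgap
  have hml : 0 ≤ μ * Real.log n := by positivity
  have h3 : 0 ≤ μ * Real.log n * (4 - 3 * γ + γ ^ 2 / 2 + 2 * γ ^ 3) :=
    mul_nonneg hml (by
      have := pow_pos hγ 2
      have := pow_pos hγ 3
      linarith)
  have e3 : 3 * (5 / (6 * γ * μ)) = 4 * (5 / (8 * γ * μ)) := by field_simp; norm_num
  linarith

theorem half_pow_epochs_mul_le {B ε : ℝ} (hB : 0 < B) (hε : 0 < ε) :
    (1 / 2) ^ epochs B ε * B ≤ ε := by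
  have h1 : B / ε ≤ 2 ^ epochs B ε := by
    rw [← Real.rpow_natCast, ← Real.logb_le_iff_le_rpow (by norm_num) (by positivity)]
    exact Nat.le_ceil _
  rw [div_le_iff₀ hε] at h1
  rw [one_div, inv_pow, inv_mul_le_iff₀ (by positivity)]
  exact h1

end Recursion

/-! ### Expected convergence -/

section Stochastic

variable {S A Ω : Type*} [Fintype S] [Fintype A] [m : MeasurableSpace Ω]
  {ℙ : Measure Ω} [IsProbabilityMeasure ℙ] {ℱ : Filtration ℕ m} {M : MDP S A}
  {h : S → (A → ℝ) → ℝ} {gradh : S → (A → ℝ) → (A → ℝ)} {μ L : ℝ} {R : S → Set (A → ℝ)}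
  {T : ℕ → ℕ} {Qhat : ℕ → Ω → S → A → ℝ} {π v : ℕ → Ω → S → A → ℝ} {x y : ℕ → ℕ → Ω → S → A → ℝ}
  {πs : S → A → ℝ} {ν : S → ℝ} [Nonempty A]

omit [Nonempty A] in
theorem objective_le_of_isOptimal (hπs : IsOptimal M h πs) (hν : ν ∈ stdSimplex ℝ S)
    {π : S → A → ℝ} (hπ : IsPolicy π) : 0 ≤ objective M h ν π - objective M h ν πs :=
  sub_nonneg.2 (Finset.sum_le_sum fun s _ => mul_le_mul_of_nonneg_left (hπs.2 π hπ s) (hν.1 s))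

namespace IsStochasticRun

theorem integrable_potential (H : IsStochasticRun ℙ ℱ M h gradh μ L R T Qhat π v x y)
    (hπs : IsPolicy πs) (k : ℕ) :
    Integrable (fun ω => objective M h ν (π k ω) - objective M h ν πs
      + μ / (1 - M.γ) * avgDist ν (v k ω) πs) ℙ :=
  ((H.integrable_objective k).sub (integrable_const _)).add
    ((H.integrable_avgDist k hπs).const_mul _)

theorem integral_potential_succ_le (H : IsStochasticRun ℙ ℱ M h gradh μ L R T Qhat π v x y)
    (hπs : IsPolicy πs) (hν : IsStationary M πs ν) (k : ℕ) :
    ∫ ω, (objective M h ν (π (k + 1) ω) - objective M h ν πs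
        + μ / (1 - M.γ) * avgDist ν (v (k + 1) ω) πs) ∂ℙ
      ≤ M.γ * ∫ ω, (objective M h ν (π k ω) - objective M h ν πs
          + μ / (1 - M.γ) * avgDist ν (v k ω) πs) ∂ℙ
        + (M.γ * μ * (1 + 3 / 2 * M.γ + M.γ ^ 2) * Real.log (Fintype.card A)
          + 5 / (6 * M.γ * μ) + 2 * (1 - M.γ)) * decay M.γ k := by
  have hγ := M.γ_pos
  have hμ := H.μ_pos
  have hpair : ∀ s, Integrable
      (fun ω => pair (Qhat k ω s - Q M h (π k ω) s) (π k ω s - πs s)) ℙ := fun s =>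
    integrable_finsetSum _ fun a _ => H.integrable_error_mul hπs k s a
  have hI1 := (H.integrable_potential (ν := ν) hπs k).const_mul M.γ
  have hI2 : Integrable (fun ω => M.γ * μ * (1 + 3 / 2 * M.γ + M.γ ^ 2) * decay M.γ k
      * Real.log (Fintype.card A) + 5 / (6 * M.γ * μ) * ‖Qhat k ω - Q M h (π k ω)‖ ^ 2) ℙ :=
    (integrable_const _).add ((H.est.integrable k).const_mul _)
  have hI3 : Integrable (fun ω => ∑ s, ν s *
      pair (Qhat k ω s - Q M h (π k ω) s) (π k ω s - πs s)) ℙ :=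
    integrable_finsetSum _ fun s _ => (hpair s).const_mul _
  have h1 := integral_mono_ae (H.integrable_potential (ν := ν) hπs (k + 1))
    (hI1.add (hI2.sub hI3)) (by
      filter_upwards [H.mem] with ω hω
      exact (H.run ω).potential_succ_le hμ H.L_nonneg H.reg H.smooth H.steps hω hπs hν k)
  refine h1.trans ?_
  rw [integral_add' hI1 (hI2.sub hI3), integral_sub' hI2 hI3, integral_const_mul,
    integral_add (integrable_const _) ((H.est.integrable k).const_mul _), integral_const_mul,
    integral_finsetSum _ fun s _ => (hpair s).const_mul _]
  simp only [integral_const, probReal_univ, one_smul, integral_const_mul]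
  have h2 := mul_le_mul_of_nonneg_left (H.integral_norm_sq_le k)
    (by positivity : 0 ≤ 5 / (6 * M.γ * μ))
  have h3 : -(2 * ((1 - M.γ) * decay M.γ k)) ≤ ∑ s, ν s *
      ∫ ω, pair (Qhat k ω s - Q M h (π k ω) s) (π k ω s - πs s) ∂ℙ := by
    calc -(2 * ((1 - M.γ) * decay M.γ k)) = ∑ s, ν s * -(2 * ((1 - M.γ) * decay M.γ k)) := by
          rw [← Finset.sum_mul, hν.1.2, one_mul]
      _ ≤ _ := Finset.sum_le_sum fun s _ =>
          mul_le_mul_of_nonneg_left (H.neg_le_integral_pair hπs k s) (hν.1.1 s)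
  linarith

theorem integral_potential_le (H : IsStochasticRun ℙ ℱ M h gradh μ L R T Qhat π v x y)
    (hπs : IsOptimal M h πs) (hν : IsStationary M πs ν) {B : ℝ}
    (hB : B = rateConst M.γ μ (objective M h ν (uniformPolicy S A) - objective M h ν πs)
      (Fintype.card A)) (k : ℕ) :
    ∫ ω, (objective M h ν (π k ω) - objective M h ν πs
        + μ / (1 - M.γ) * avgDist ν (v k ω) πs) ∂ℙ ≤ (1 / 2) ^ (k / epochLen M.γ) * B := by
  have hγ1 : 0 < 1 - M.γ := by linarith [M.γ_lt_one]
  have hu : IsPolicy (uniformPolicy S A) := fun s => (uniformPolicy_mem s).1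
  obtain ⟨hB0, hB1, hB2⟩ := rateConst_facts (n := Fintype.card A) M.γ_pos M.γ_lt_one H.μ_pos
    (objective_le_of_isOptimal hπs hν.1 hu)
  rw [← hB] at hB0 hB1 hB2
  refine le_half_pow_of_recursion (X := fun k => ∫ ω, (objective M h ν (π k ω)
    - objective M h ν πs + μ / (1 - M.γ) * avgDist ν (v k ω) πs) ∂ℙ) M.γ_pos M.γ_lt_one hB0.le ?_
    hB2 (H.integral_potential_succ_le hπs.1 hν) k
  have h0 : ∀ ω, π 0 ω = uniformPolicy S A ∧ v 0 ω = uniformPolicy S A := fun ω =>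
    ⟨(H.run ω).π_zero, (H.run ω).v_zero⟩
  simp only [h0, integral_const, probReal_univ, one_smul]
  refine le_trans (add_le_add_right (mul_le_mul_of_nonneg_left ?_
    (div_pos H.μ_pos hγ1).le) _) hB1
  calc avgDist ν (uniformPolicy S A) πs ≤ ∑ s, ν s * Real.log (Fintype.card A) :=
        Finset.sum_le_sum fun s _ => mul_le_mul_of_nonneg_left
          (KL_uniformPolicy_le s (hπs.1 s)) (hν.1.1 s)
    _ = Real.log (Fintype.card A) := by rw [← Finset.sum_mul, hν.1.2, one_mul]

omit [IsProbabilityMeasure ℙ] in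
theorem ae_avgDist_bounds (H : IsStochasticRun ℙ ℱ M h gradh μ L R T Qhat π v x y)
    (hπs : IsPolicy πs) (hν : ν ∈ stdSimplex ℝ S) (k : ℕ) {lam : ℝ}
    (hlam : lam = 2 - Real.log (Real.sqrt (subModulus M.γ μ / subSmooth M.γ μ L))) :
    ∀ᵐ ω ∂ℙ, 0 ≤ avgDist ν (v k ω) πs ∧ 0 ≤ avgDist ν (π k ω) πs ∧
      avgDist ν (π k ω) πs ≤ lam * avgDist ν (v k ω) πs
      + 2 * lam * (M.γ * ((1 - M.γ) ^ 2 * decay M.γ k * Real.log (Fintype.card A))) := by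
  filter_upwards [H.mem] with ω hω
  have hmem := (H.run ω).mem_posSimplex H.smooth.subset hω k
  exact ⟨Finset.sum_nonneg fun s _ => mul_nonneg (hν.1 s) (KL_nonneg (hπs s) (hmem s).2),
    Finset.sum_nonneg fun s _ => mul_nonneg (hν.1 s) (KL_nonneg (hπs s) (hmem s).1),
    (H.run ω).avgDist_le H.μ_pos H.L_nonneg H.reg H.smooth H.steps hω hπs hν k hlam⟩

theorem integrable_avgDist_π (H : IsStochasticRun ℙ ℱ M h gradh μ L R T Qhat π v x y)
    (hπs : IsPolicy πs) (hν : ν ∈ stdSimplex ℝ S) (k : ℕ) :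
    Integrable (fun ω => avgDist ν (π k ω) πs) ℙ := by
  obtain ⟨lam, hlam⟩ : ∃ lam, lam
    = 2 - Real.log (Real.sqrt (subModulus M.γ μ / subSmooth M.γ μ L)) := ⟨_, rfl⟩
  refine (((H.integrable_avgDist (ν := ν) k hπs).const_mul lam).add (integrable_const (2 * lam
    * (M.γ * ((1 - M.γ) ^ 2 * decay M.γ k * Real.log (Fintype.card A)))))).mono'
    (Finset.measurable_fun_sum _ fun s _ =>
      (measurable_KL (πs s) (H.measurable_π k s)).const_mul _).aestronglyMeasurable ?_
  filter_upwards [H.ae_avgDist_bounds hπs hν k hlam] with ω hω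
  rw [Real.norm_eq_abs, abs_of_nonneg hω.2.1]
  exact hω.2.2

theorem integral_policy_potential_le (H : IsStochasticRun ℙ ℱ M h gradh μ L R T Qhat π v x y)
    (hπs : IsOptimal M h πs) (hν : IsStationary M πs ν) {B : ℝ}
    (hB : B = rateConst M.γ μ (objective M h ν (uniformPolicy S A) - objective M h ν πs)
      (Fintype.card A)) (k : ℕ) :
    ∫ ω, (objective M h ν (π k ω) - objective M h ν πs
        + μ / (1 - M.γ) * avgDist ν (π k ω) πs) ∂ℙ
      ≤ 20 * (1 + Real.log (condNumber M.γ μ L)) * ((1 / 2) ^ (k / epochLen M.γ) * B) := by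
  have hγ := M.γ_pos
  have hγ1 : 0 < 1 - M.γ := by linarith [M.γ_lt_one]
  have hμ := H.μ_pos
  have hc : 0 < μ / (1 - M.γ) := div_pos hμ hγ1
  have hu : IsPolicy (uniformPolicy S A) := fun s => (uniformPolicy_mem s).1
  have hgap := objective_le_of_isOptimal hπs hν.1 hu
  obtain ⟨hB0, hB1, -⟩ := rateConst_facts (n := Fintype.card A) hγ M.γ_lt_one hμ hgap
  rw [← hB] at hB0 hB1
  obtain ⟨lam, hlam⟩ : ∃ lam, lam
    = 2 - Real.log (Real.sqrt (subModulus M.γ μ / subSmooth M.γ μ L)) := ⟨_, rfl⟩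
  have hκ : 0 ≤ Real.log (condNumber M.γ μ L) := Real.log_nonneg one_le_condNumber
  have hlam' : lam = 2 + (Real.log 2 + Real.log (condNumber M.γ μ L) / 2) := by
    rw [hlam, ← neg_log_sqrt_subModulus_div hγ hμ]; ring
  have hlog2 := Real.log_two_lt_d9
  have hlog2' := Real.log_two_gt_d9
  have hlam1 : 1 ≤ lam := by linarith
  set D := M.γ * ((1 - M.γ) ^ 2 * decay M.γ k * Real.log (Fintype.card A)) with hD
  have hI := H.integrable_potential (ν := ν) hπs.1 k
  have h1 : ∫ ω, (objective M h ν (π k ω) - objective M h ν πs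
        + μ / (1 - M.γ) * avgDist ν (π k ω) πs) ∂ℙ
      ≤ ∫ ω, (lam * (objective M h ν (π k ω) - objective M h ν πs
        + μ / (1 - M.γ) * avgDist ν (v k ω) πs) + μ / (1 - M.γ) * (2 * lam * D)) ∂ℙ := by
    refine integral_mono_ae (((H.integrable_objective k).sub (integrable_const _)).add
      ((H.integrable_avgDist_π hπs.1 hν.1 k).const_mul _))
      ((hI.const_mul _).add (integrable_const _)) ?_
    filter_upwards [H.ae_avgDist_bounds hπs.1 hν.1 k hlam] with ω hω
    have h2 := mul_le_mul_of_nonneg_left hω.2.2 hc.le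
    -- Optimality makes the gap nonnegative, so it may also be multiplied by `lam ≥ 1`.
    have h3 := mul_nonneg (by linarith : 0 ≤ lam - 1)
      (objective_le_of_isOptimal hπs hν.1 (H.isPolicy k ω))
    linarith
  rw [integral_add (hI.const_mul _) (integrable_const _), integral_const_mul] at h1
  simp only [integral_const, probReal_univ, one_smul] at h1
  have h4 := mul_le_mul_of_nonneg_left (H.integral_potential_le hπs hν hB k)
    (by linarith : 0 ≤ lam)
  set W := (1 / 2 : ℝ) ^ (k / epochLen M.γ) * B with hW
  have hW0 : 0 ≤ W := by positivity
  -- The distance between `π k` and `v k` decays at the same rate, and `μ log|A|/(1-γ)` is already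
  -- part of `B`.
  have h5 : μ / (1 - M.γ) * (2 * lam * D) ≤ lam * (1 / 2) * W := by
    have hdec : decay M.γ k = (1 / 2 : ℝ) ^ (k / epochLen M.γ) / 4 := by
      rw [decay, pow_add]; ring
    have h6 : μ / (1 - M.γ) * Real.log (Fintype.card A) ≤ B := by linarith
    have h7 : M.γ * (1 - M.γ) ^ 2 ≤ 1 := by
      have : (1 - M.γ) ^ 2 ≤ 1 := pow_le_one₀ hγ1.le (by linarith)
      exact mul_le_one₀ M.γ_lt_one.le (by positivity) this
    have e : μ / (1 - M.γ) * (2 * lam * D) = lam * (1 / 2) * (1 / 2 : ℝ) ^ (k / epochLen M.γ)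
        * ((M.γ * (1 - M.γ) ^ 2) * (μ / (1 - M.γ) * Real.log (Fintype.card A))) := by
      rw [hD, hdec]; ring
    rw [e, hW, ← mul_assoc (lam * (1 / 2)) _ B]
    refine mul_le_mul_of_nonneg_left ?_ (mul_nonneg (by linarith) (by positivity))
    have h8 : 0 ≤ μ / (1 - M.γ) * Real.log (Fintype.card A) :=
      mul_nonneg hc.le (Real.log_natCast_nonneg _)
    exact (mul_le_of_le_one_left h8 h7).trans h6
  have h9 : lam + lam * (1 / 2) ≤ 20 * (1 + Real.log (condNumber M.γ μ L)) := by
    rw [hlam']; linarith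
  have h10 := mul_le_mul_of_nonneg_right h9 hW0
  linarith

theorem integral_gap_le (H : IsStochasticRun ℙ ℱ M h gradh μ L R T Qhat π v x y)
    (hπs : IsOptimal M h πs) (hν : IsStationary M πs ν) {B : ℝ}
    (hB : B = rateConst M.γ μ (objective M h ν (uniformPolicy S A) - objective M h ν πs)
      (Fintype.card A)) {ε : ℝ} (hε : 0 < ε) :
    ∫ ω, (objective M h ν (π (epochLen M.γ * epochs B ε) ω) - objective M h ν πs) ∂ℙ ≤ ε := by
  have hγ1 : 0 < 1 - M.γ := by linarith [M.γ_lt_one]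
  have hu : IsPolicy (uniformPolicy S A) := fun s => (uniformPolicy_mem s).1
  have hB0 : 0 < B := hB ▸ (rateConst_facts M.γ_pos M.γ_lt_one H.μ_pos
    (objective_le_of_isOptimal hπs hν.1 hu)).1
  set K := epochLen M.γ * epochs B ε with hK
  have h1 := H.integral_potential_le hπs hν hB K
  rw [hK, Nat.mul_div_cancel_left _ (epochLen_pos M.γ_pos M.γ_lt_one), ← hK] at h1
  refine (integral_mono_ae ((H.integrable_objective K).sub (integrable_const _))
    (H.integrable_potential hπs.1 K) ?_).trans (h1.trans (half_pow_epochs_mul_le hB0 hε))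
  filter_upwards [H.ae_avgDist_bounds hπs.1 hν.1 K rfl] with ω hω
  exact le_add_of_nonneg_right (mul_nonneg (div_pos H.μ_pos hγ1).le hω.1)

end IsStochasticRun
end Stochastic

/-! ### Number of gradient evaluations -/

section Complexity

variable {γ μ L : ℝ}

/-- Only the linear rate is used, through `1 - α ≤ exp(-α)`. The shift `n + 1` matches the exponent
`t - 1` in the accuracy. -/
theorem agdAccuracy_le_of_log_le {Λ m τ : ℝ} (hm : 0 < m) (hΛ : 4 * m ≤ Λ) (hτ : 0 < τ) {n : ℕ}
    (hn : Real.log (2 * Λ / τ) / Real.sqrt (m / Λ) ≤ n) : agdAccuracy Λ m (n + 1) ≤ τ := by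
  obtain ⟨hα, hα2, -⟩ := sqrt_div_facts hm hΛ
  have hΛ0 : 0 < Λ := by linarith
  rw [div_le_iff₀ hα] at hn
  set α := Real.sqrt (m / Λ) with hαd
  have h1 : (1 - α) ^ n ≤ τ / (2 * Λ) := by
    calc (1 - α) ^ n ≤ Real.exp (-α) ^ n :=
          pow_le_pow_left₀ (by linarith) (Real.one_sub_le_exp_neg α) n
      _ = Real.exp (-(n * α)) := by rw [← Real.exp_nat_mul]; congr 1; ring
      _ ≤ Real.exp (-Real.log (2 * Λ / τ)) := Real.exp_le_exp.2 (by linarith)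
      _ = τ / (2 * Λ) := by rw [Real.exp_neg, Real.exp_log (by positivity), inv_div]
  rw [agdAccuracy, Nat.add_sub_cancel, ← hαd]
  refine (mul_le_mul_of_nonneg_left ((min_le_left _ _).trans h1) (by positivity)).trans_eq ?_
  field_simp

theorem ceil_mem_steps (hγ : 0 < γ) (hγ1 : γ < 1) (hμ : 0 < μ) (k : ℕ) :
    ⌈Real.log (2 * subSmooth γ μ L / ((1 - γ) ^ 2 * decay γ (k + 1)))
        / Real.sqrt (subModulus γ μ / subSmooth γ μ L)⌉₊ + 1 ∈
      {t : ℕ | 1 ≤ t ∧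
        agdAccuracy (subSmooth γ μ L) (subModulus γ μ) t ≤ (1 - γ) ^ 2 * decay γ (k + 1)} :=
  ⟨Nat.le_add_left _ _, agdAccuracy_le_of_log_le (subModulus_pos hγ hμ) four_mul_subModulus_le
    (mul_pos (pow_pos (by linarith) 2) (decay_pos _)) (Nat.le_ceil _)⟩

theorem admissibleSteps_leastSteps (hγ : 0 < γ) (hγ1 : γ < 1) (hμ : 0 < μ) :
    AdmissibleSteps γ μ L (leastSteps γ μ L) :=
  fun k => Nat.sInf_mem ⟨_, ceil_mem_steps hγ hγ1 hμ k⟩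

theorem log_condNumber_div_nonneg (hγ : 0 < γ) (hγ1 : γ < 1) :
    0 ≤ Real.log (condNumber γ μ L / (γ * (1 - γ) ^ 2)) := by
  have h1 : 0 < 1 - γ := by linarith
  refine Real.log_nonneg ((one_le_div (by positivity)).2 (le_trans ?_ one_le_condNumber))
  exact mul_le_one₀ hγ1.le (by positivity) (pow_le_one₀ h1.le (by linarith))

theorem leastSteps_le (hγ : 0 < γ) (hγ1 : γ < 1) (hμ : 0 < μ) {k n : ℕ}
    (hk : k < epochLen γ * n) :
    (leastSteps γ μ L k : ℝ) ≤ 20 * Real.sqrt (condNumber γ μ L)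
      * (n + Real.log (condNumber γ μ L / (γ * (1 - γ) ^ 2))) := by
  have h1γ : 0 < 1 - γ := by linarith
  have hl := epochLen_pos hγ hγ1
  have hn : (1 : ℝ) ≤ n := by
    exact_mod_cast Nat.pos_of_ne_zero fun h => by simp [h] at hk
  have hκ1 : 1 ≤ condNumber γ μ L := one_le_condNumber
  have hW := log_condNumber_div_nonneg (μ := μ) (L := L) hγ hγ1
  have hs1 : 1 ≤ Real.sqrt (condNumber γ μ L) := Real.one_le_sqrt.2 hκ1
  have hle : leastSteps γ μ L k ≤ _ := Nat.sInf_le (ceil_mem_steps (L := L) hγ hγ1 hμ k)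
  -- As `k + 1 ≤ l n`, every tolerance is at least the one reached after `n` epochs.
  have hdec : (1 / 2 : ℝ) ^ (n + 2) ≤ decay γ (k + 1) :=
    pow_le_pow_of_le_one (by norm_num) (by norm_num)
      (Nat.add_le_add_right (Nat.div_le_of_le_mul hk) 2)
  set κ := condNumber γ μ L
  have hΛ : 2 * subSmooth γ μ L = 8 * κ / γ := by
    rw [subSmooth_eq hγ hμ, subModulus_eq hγ hμ]; ring
  -- The exponent `n + 5` collects `2^{n+2}` from the tolerance and the 8 in `2Λ = 8κ/γ`.
  have hlog : Real.log (2 * subSmooth γ μ L / ((1 - γ) ^ 2 * decay γ (k + 1)))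
      ≤ (n + 5) * Real.log 2 + Real.log (κ / (γ * (1 - γ) ^ 2)) := by
    have e : ((n : ℝ) + 5) * Real.log 2 + Real.log (κ / (γ * (1 - γ) ^ 2))
        = Real.log (2 ^ (n + 5) * (κ / (γ * (1 - γ) ^ 2))) := by
      rw [Real.log_mul (by positivity) (by positivity), Real.log_pow]
      push_cast; ring
    have hd := decay_pos (γ := γ) (k + 1)
    rw [e, hΛ]
    refine Real.log_le_log (by positivity) ?_
    have e2 : (2 : ℝ) ^ (n + 5) * (κ / (γ * (1 - γ) ^ 2))
        = 8 * κ / γ / ((1 - γ) ^ 2 * (1 / 2) ^ (n + 2)) := by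
      rw [one_div, inv_pow, pow_add, pow_add]
      field_simp
      norm_num
    rw [e2]
    gcongr
  have hlog0 : 0 ≤ (n + 5) * Real.log 2 + Real.log (κ / (γ * (1 - γ) ^ 2)) :=
    add_nonneg (mul_nonneg (by positivity) (Real.log_nonneg (by norm_num))) hW
  have hceil : (⌈Real.log (2 * subSmooth γ μ L / ((1 - γ) ^ 2 * decay γ (k + 1)))
        / Real.sqrt (subModulus γ μ / subSmooth γ μ L)⌉₊ : ℝ)
      ≤ ((n + 5) * Real.log 2 + Real.log (κ / (γ * (1 - γ) ^ 2))) * (2 * Real.sqrt κ) + 1 := by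
    rw [sqrt_subModulus_div hγ hμ, div_div_eq_mul_div, div_one]
    refine (Nat.cast_le.2 (Nat.ceil_mono (mul_le_mul_of_nonneg_right hlog (by positivity)))).trans
      (Nat.ceil_lt_add_one (by positivity)).le
  have hle' : (leastSteps γ μ L k : ℝ) ≤ _ := Nat.cast_le.2 hle
  push_cast at hle'
  refine hle'.trans ((add_le_add_left hceil 1).trans ?_)
  set W := Real.log (κ / (γ * (1 - γ) ^ 2))
  have hlog2 := Real.log_two_lt_d9
  have h3 : (n + 5) * Real.log 2 + W ≤ 5 * n + W := by nlinarith
  have h4 := mul_le_mul_of_nonneg_right h3 (by positivity : 0 ≤ 2 * Real.sqrt κ)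
  have h5 : 1 ≤ Real.sqrt κ * n := one_le_mul_of_one_le_of_one_le hs1 hn
  have h6 : 0 ≤ Real.sqrt κ * W := by positivity
  linarith

theorem gradEvals_le (hγ : 0 < γ) (hγ1 : γ < 1) (hμ : 0 < μ) (n : ℕ) :
    (gradEvals (leastSteps γ μ L) (epochLen γ * n) : ℝ)
      ≤ 20 * (epochLen γ * n) * Real.sqrt (condNumber γ μ L)
        * (n + Real.log (condNumber γ μ L / (γ * (1 - γ) ^ 2))) := by
  rw [gradEvals, Nat.cast_sum]
  refine (Finset.sum_le_card_nsmul _ _ _ fun k hk =>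
    leastSteps_le hγ hγ1 hμ (Finset.mem_range.1 hk)).trans_eq ?_
  rw [Finset.card_range, nsmul_eq_mul]
  push_cast
  ring

/-- Once `log(1/ε) ≥ 1`, the constant `log B` and the rounding are absorbed in a multiple of
`log(1/ε)`. -/
theorem epochs_le {B ε : ℝ} (hB : 0 < B) (hε : 0 < ε) (hlog : 1 ≤ Real.log (1 / ε)) :
    (epochs B ε : ℝ) ≤ ((|Real.log B| + 1) / Real.log 2 + 1) * Real.log (1 / ε) := by
  have hl2 : 0 < Real.log 2 := Real.log_pos (by norm_num)
  have hB' := abs_nonneg (Real.log B)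
  have h1 : Real.logb 2 (B / ε) ≤ (|Real.log B| + 1) / Real.log 2 * Real.log (1 / ε) := by
    rw [Real.logb, div_mul_eq_mul_div]
    refine div_le_div_of_nonneg_right ?_ hl2.le
    rw [div_eq_mul_one_div, Real.log_mul hB.ne' (by positivity)]
    nlinarith [le_abs_self (Real.log B)]
  have h2 : (epochs B ε : ℝ) ≤ (|Real.log B| + 1) / Real.log 2 * Real.log (1 / ε) + 1 :=
    (Nat.cast_le.2 (Nat.ceil_mono h1)).trans (Nat.ceil_lt_add_one (by positivity)).le
  linarith

theorem isBigO_gradEvals (hγ : 0 < γ) (hγ1 : γ < 1) (hμ : 0 < μ) {B : ℝ} (hB : 0 < B) :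
    (fun ε : ℝ => (gradEvals (leastSteps γ μ L) (epochLen γ * epochs B ε) : ℝ))
      =O[𝓝[>] 0] (fun ε : ℝ => Real.logb γ ε * Real.sqrt (condNumber γ μ L)
        * Real.log (1 / ε)) := by
  have hW := log_condNumber_div_nonneg (μ := μ) (L := L) hγ hγ1
  have hl2 : 0 < Real.log 2 := Real.log_pos (by norm_num)
  set W := Real.log (condNumber γ μ L / (γ * (1 - γ) ^ 2))
  set c := (|Real.log B| + 1) / Real.log 2 + 1
  have hc : 0 ≤ c := by positivity
  have hlγ : Real.log γ < 0 := Real.log_neg hγ hγ1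
  refine Asymptotics.IsBigO.of_bound (20 * epochLen γ * c * (c + W) * -Real.log γ) ?_
  filter_upwards [Ioo_mem_nhdsGT (Real.exp_pos (-1))] with ε hε
  have hlog : 1 ≤ Real.log (1 / ε) := by
    have := Real.log_lt_log hε.1 hε.2
    rw [Real.log_exp] at this
    rw [one_div, Real.log_inv]
    linarith
  have h1 := epochs_le hB hε.1 hlog
  have h2 := gradEvals_le (L := L) hγ hγ1 hμ (epochs B ε)
  have e : Real.logb γ ε = Real.log (1 / ε) / -Real.log γ := by
    rw [Real.logb, one_div, Real.log_inv, neg_div_neg_eq]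
  rw [Real.norm_of_nonneg (Nat.cast_nonneg _), e]
  set ℓ := Real.log (1 / ε)
  have hγ' : 0 < -Real.log γ := by linarith
  rw [Real.norm_of_nonneg (by positivity)]
  refine h2.trans ?_
  have h3 : 20 * (epochLen γ * (epochs B ε : ℝ)) * Real.sqrt (condNumber γ μ L)
      * ((epochs B ε : ℝ) + W)
      ≤ 20 * (epochLen γ * (c * ℓ)) * Real.sqrt (condNumber γ μ L) * (c * ℓ + W * ℓ) := by
    gcongr
    exact le_mul_of_one_le_right hW hlog
  refine h3.trans_eq ?_
  have := hlγ.ne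
  field_simp

end Complexity

end PMD

theorem mainTheorem11 {S A Ω : Type*} [Fintype S] [Fintype A]
    [m : MeasurableSpace Ω] (ℙ : Measure Ω) [IsProbabilityMeasure ℙ]
    (M : MDP S A) (h : S → (A → ℝ) → ℝ) (gradh : S → (A → ℝ) → (A → ℝ))
    (μ L : ℝ) (hμ : 0 < μ) (hL : 0 ≤ L)
    (hh : IsStronglyConvexReg h gradh μ)
    (πs : S → A → ℝ) (hπs : IsOptimal M h πs)
    (νs : S → ℝ) (hνs : IsStationary M πs νs)
    (f : (S → A → ℝ) → ℝ) (hf : f = objective M h νs)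
    (B : ℝ) (hB : B = rateConst M.γ μ (f (uniformPolicy S A) - f πs) (Fintype.card A)) :
    (∀ (R : S → Set (A → ℝ)) (ℱ : Filtration ℕ m) (T : ℕ → ℕ)
        (Qhat : ℕ → Ω → S → A → ℝ) (π v : ℕ → Ω → S → A → ℝ) (x y : ℕ → ℕ → Ω → S → A → ℝ),
      IsSmoothOn gradh L R →
      AdmissibleSteps M.γ μ L T →
      (∀ ω, IsInexactSPMD M gradh μ L T (fun k => Qhat k ω) (fun k => π k ω) (fun k => v k ω)
        (fun k t => x k t ω) (fun k t => y k t ω)) →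
      (∀ᵐ ω ∂ℙ, ∀ k s, ∀ t ≤ T k, x k t ω s ∈ R s ∧ y k t ω s ∈ R s) →
      (∀ k s a, StronglyMeasurable[ℱ k] (fun ω => π k ω s a) ∧
        StronglyMeasurable[ℱ k] (fun ω => v k ω s a)) →
      IsEstimator ℙ ℱ M h (fun k => (1 - M.γ) * decay M.γ k) (fun k => decay M.γ k) Qhat π →
      (∀ k,
        Integrable (fun ω => f (π k ω) - f πs + μ / (1 - M.γ) * avgDist νs (v k ω) πs) ℙ ∧
        ∫ ω, (f (π k ω) - f πs + μ / (1 - M.γ) * avgDist νs (v k ω) πs) ∂ℙ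
          ≤ (1 / 2) ^ (k / epochLen M.γ) * B ∧
        Integrable (fun ω => f (π k ω) - f πs + μ / (1 - M.γ) * avgDist νs (π k ω) πs) ℙ ∧
        ∫ ω, (f (π k ω) - f πs + μ / (1 - M.γ) * avgDist νs (π k ω) πs) ∂ℙ
          ≤ 20 * (1 + Real.log (condNumber M.γ μ L)) * ((1 / 2) ^ (k / epochLen M.γ) * B)) ∧
      (∀ ε > 0, Integrable (fun ω => f (π (epochLen M.γ * epochs B ε) ω) - f πs) ℙ ∧
        ∫ ω, (f (π (epochLen M.γ * epochs B ε) ω) - f πs) ∂ℙ ≤ ε)) ∧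
    AdmissibleSteps M.γ μ L (leastSteps M.γ μ L) ∧
    (∀ ε > 0, (gradEvals (leastSteps M.γ μ L) (epochLen M.γ * epochs B ε) : ℝ)
      ≤ 20 * (epochLen M.γ * epochs B ε) * Real.sqrt (condNumber M.γ μ L)
        * (epochs B ε + Real.log (condNumber M.γ μ L / (M.γ * (1 - M.γ) ^ 2)))) ∧
    (fun ε : ℝ => (gradEvals (leastSteps M.γ μ L) (epochLen M.γ * epochs B ε) : ℝ))
      =O[𝓝[>] 0] (fun ε : ℝ => Real.logb M.γ ε * Real.sqrt (condNumber M.γ μ L)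
        * Real.log (1 / ε)) := by
  subst hf
  have hγ := M.γ_pos
  have hγ1 := M.γ_lt_one
  -- A sum of probabilities equal to one excludes an empty state space, and likewise an empty action
  -- space.
  obtain ⟨s₀⟩ : Nonempty S := by
    by_contra hS
    rw [not_nonempty_iff] at hS
    simpa using hνs.1.2
  have : Nonempty A := by
    by_contra hA
    rw [not_nonempty_iff] at hA
    simpa using (hπs.1 s₀).2
  have hB0 : 0 < B := hB ▸ (rateConst_facts hγ hγ1 hμ (objective_le_of_isOptimal hπs hνs.1
    fun s => (uniformPolicy_mem s).1)).1
  refine ⟨fun R ℱ T Qhat π v x y hS hT hrun hR hmeas hest => ?_,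
    admissibleSteps_leastSteps hγ hγ1 hμ, fun ε _ => gradEvals_le hγ hγ1 hμ (epochs B ε),
    isBigO_gradEvals hγ hγ1 hμ hB0⟩
  have H : IsStochasticRun ℙ ℱ M h gradh μ L R T Qhat π v x y :=
    ⟨hμ, hL, hh, hS, hT, hrun, hR, hmeas, hest⟩
  have hgap : ∀ k, Integrable (fun ω => objective M h νs (π k ω) - objective M h νs πs) ℙ :=
    fun k => (H.integrable_objective k).sub (integrable_const _)
  exact ⟨fun k => ⟨H.integrable_potential hπs.1 k, H.integral_potential_le hπs hνs hB k,
    (hgap k).add ((H.integrable_avgDist_π hπs.1 hνs.1 k).const_mul _),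
    H.integral_policy_potential_le hπs hνs hB k⟩,
    fun ε hε => ⟨hgap _, H.integral_gap_le hπs hνs hB hε⟩⟩
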